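/- **Conventions.** $|\cdot|$ is the Euclidean norm and $B_r(y)$ the open Euclidean ball. A neural network $\Phi$ is a finite sequence $((A_1,b_1),\dots,(A_L,b_L))$, $L\ge 1$, of real matrices $A_\ell\in\mathbb R^{N_\ell\times N_{\ell-1}}$ and vectors $b_\ell\in\mathbb R^{N_\ell}$ (all $N_\ell\ge 1$). Its ReLU realization $\mathrm R(\Phi):\mathbb R^{N_0}\to\mathbb R^{N_L}$ is $x\mapsto x_L$, where $x_0=x$, $x_\ell=\max\{0,A_\ell x_{\ell-1}+b_\ell\}$ componentwise for $\ell<L$, and $x_L=A_Lx_{L-1}+b_L$. The depth is $L(\Phi)=L$ and the number of weights $W(\Phi)$ is the total number of nonzero entries of all $A_\ell$ and $b_\ell$. For a smooth embedded $d$-dimensional submanifold $\Gamma\subset\mathbb R^D$ (without boundary, not necessarily closed) and $y\in\Gamma$, let $\mathrm P_{y,\Gamma}$ be the orthogonal projection of $\mathbb R^D$ onto the tangent space $T_y\Gamma$. Call $\delta>0$ *admissible* for $\Gamma$ if for every $y\in\Gamma$ the map $\mathrm P_{y,\Gamma}: B_\delta(y)\cap\Gamma\to V_y\subset T_y\Gamma$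 is a diffeomorphism onto an open subset $V_y$ of $T_y\Gamma$ and its inverse is $2$-Lipschitz. **Theorem.** Let $d\ge 1$. (1) If $\Gamma\subset\mathbb R^D$ is a smooth $d$-dimensional submanifold that is compact, or more generally is contained in a compact subset of some smooth $d$-dimensional submanifold of $\mathbb R^D$, then an admissible $\delta>0$ exists for $\Gamma$. (2) There are a universal integer $c>0$ and constants $K_1=K_1(d,C,\max\{1,\delta\})$, depending only on the listed quantities, such that the following holds. Let $D\ge 1$, let $\Gamma\subset[0,1]^D$ be a smooth $d$-dimensional submanifold, let $\delta>0$ be admissible for $\Gamma$, and let $M$ be the minimum number of balls $B_{\delta/4}(y_i)$ with centers $y_i\in\Gamma$ that cover $\Gamma$. Then there are constants $K_2=K_2(\Gamma,\delta,C)$ and, for every $q\ge1$, a radius $r_0=r_0(\Gamma,\delta,q)>0$, such that for every $C>0$, every $C$-Lipschitz function $f:\Gamma\to[0,1]^q$ and every $\epsilon\in(0,1)$ there is a neural network $\Phi$ with $D$-dimensional input and $q$-dimensional output satisfying - $|f(x)-\mathrm R(\Phi)(x)|\le\epsilon$ for all $x\in\Gamma$, - $W(\Phi)\le K_1\,q\,M^{d+1}\epsilon^{-d}+K_2$,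 - $L(\Phi)=\lceil\log_2 d\rceil+\lceil\log_2 D\rceil+c$, - $\mathrm R(\Phi)([0,1]^D)\subset[0,1]^q$, and such that for every Gaussian random vector $\eta$ in $\mathbb R^D$ with mean zero and covariance matrix $\sigma^2 I$, $0<\sigma^2\le r_0^2$, $$ \mathbb E\Big(\sup_{x\in\Gamma}\big|\mathrm R(\Phi)(x+\eta)-\mathrm R(\Phi)(x)\big|^2\Big)\le\frac{8C^2}{D}\,\mathbb E(|\eta|^2)\Big(\sqrt{2d\log M}+2\log M+d\Big)+8\epsilon^2+2D\,e^{-r_0^2/(2\sigma^2)} . $$ -/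

import Mathlib

open MeasureTheory ProbabilityTheory
open scoped NNReal ENNReal ContDiff

noncomputable section

/-- A neural network with `n` inputs and `m` outputs, that is, a nonempty finite sequence of
matrix-vector pairs `((A₁, b₁), …, (A_L, b_L))` with compatible sizes `n = N₀, N₁, …, N_L = m`.
The constructor `layer` prepends a pair `(A, b)` to a network; all hidden widths are positive. -/
inductive NeuralNetwork : ℕ → ℕ → Type
  | output {n m : ℕ} (A : Matrix (Fin m) (Fin n) ℝ) (b : Fin m → ℝ) : NeuralNetwork n m
  | layer {n k m : ℕ} (hk : 0 < k) (A : Matrix (Fin k) (Fin n) ℝ) (b : Fin k → ℝ)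
      (rest : NeuralNetwork k m) : NeuralNetwork n m

namespace NeuralNetwork

/-- The number of nonzero entries of `A` plus the number of nonzero entries of `b`. -/
def layerWeights {n m : ℕ} (A : Matrix (Fin m) (Fin n) ℝ) (b : Fin m → ℝ) : ℕ :=
  {p : Fin m × Fin n | A p.1 p.2 ≠ 0}.ncard + {i : Fin m | b i ≠ 0}.ncard

/-- The number of weights `W(Φ)`. -/
def weights : {n m : ℕ} → NeuralNetwork n m → ℕ
  | _, _, output A b => layerWeights A b
  | _, _, layer _ A b rest => layerWeights A b + rest.weights

/-- The number of layers `L(Φ)`. -/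
def depth : {n m : ℕ} → NeuralNetwork n m → ℕ
  | _, _, output _ _ => 1
  | _, _, layer _ _ _ rest => rest.depth + 1

/-- The ReLU realization on coordinate vectors: the activation `max 0` is applied component-wise
after every affine map except the last one. -/
def eval : {n m : ℕ} → NeuralNetwork n m → (Fin n → ℝ) → (Fin m → ℝ)
  | _, _, output A b => fun x => A.mulVec x + b
  | _, _, layer _ A b rest => fun x => rest.eval (fun i => max 0 ((A.mulVec x + b) i))

/-- The ReLU realization `R(Φ)` as a map between Euclidean spaces. -/
def realization {n m : ℕ} (Φ : NeuralNetwork n m) (x : EuclideanSpace ℝ (Fin n)) :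
    EuclideanSpace ℝ (Fin m) :=
  WithLp.toLp 2 (Φ.eval x.ofLp)

end NeuralNetwork

/-- The cube `[0,1]^n`. -/
def unitCube (n : ℕ) : Set (EuclideanSpace ℝ (Fin n)) :=
  {x | ∀ i, 0 ≤ x i ∧ x i ≤ 1}

/-- `Γ` is a smooth (embedded) `d`-dimensional submanifold of `ℝ^D`: near each of its points, `Γ`
is carried into a `d`-dimensional linear subspace by a smooth diffeomorphism between open subsets
of `ℝ^D`. -/
def IsSmoothSubmanifold {D : ℕ} (d : ℕ) (Γ : Set (EuclideanSpace ℝ (Fin D))) : Prop :=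
  ∀ y ∈ Γ, ∃ (e : OpenPartialHomeomorph (EuclideanSpace ℝ (Fin D)) (EuclideanSpace ℝ (Fin D)))
    (S : Submodule ℝ (EuclideanSpace ℝ (Fin D))),
    y ∈ e.source ∧ Module.finrank ℝ S = d ∧
    ContDiffOn ℝ ∞ e e.source ∧ ContDiffOn ℝ ∞ e.symm e.target ∧
    ∀ x ∈ e.source, x ∈ Γ ↔ e x ∈ S

/-- The tangent space `T_y Γ`, spanned by the velocities at `y` of curves in `Γ` through `y`. -/
def tangentSpaceAt {D : ℕ} (Γ : Set (EuclideanSpace ℝ (Fin D))) (y : EuclideanSpace ℝ (Fin D)) :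
    Submodule ℝ (EuclideanSpace ℝ (Fin D)) :=
  Submodule.span ℝ {v | ∃ γ : ℝ → EuclideanSpace ℝ (Fin D),
    γ 0 = y ∧ (∀ᶠ t in nhds (0 : ℝ), γ t ∈ Γ) ∧ HasDerivAt γ v 0}

/-- The orthogonal projection `P_y` onto the tangent space `T_y Γ`. -/
def tangentProj {D : ℕ} (Γ : Set (EuclideanSpace ℝ (Fin D))) (y : EuclideanSpace ℝ (Fin D)) :
    EuclideanSpace ℝ (Fin D) →L[ℝ] tangentSpaceAt Γ y :=
  (tangentSpaceAt Γ y).orthogonalProjectionOnto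

/-- For every `y ∈ Γ`, the projection `P_y` maps `B_δ(y) ∩ Γ` diffeomorphically onto an open
subset `V_y` of `T_y Γ`, and the inverse `g : V_y → B_δ(y) ∩ Γ` is `2`-Lipschitz. -/
def IsProjectionRadius {D : ℕ} (Γ : Set (EuclideanSpace ℝ (Fin D))) (δ : ℝ) : Prop :=
  ∀ y ∈ Γ, IsOpen (tangentProj Γ y '' (Metric.ball y δ ∩ Γ)) ∧
    ∃ g : tangentSpaceAt Γ y → EuclideanSpace ℝ (Fin D),
      (∀ x ∈ Metric.ball y δ ∩ Γ, g (tangentProj Γ y x) = x) ∧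
      ContDiffOn ℝ ∞ g (tangentProj Γ y '' (Metric.ball y δ ∩ Γ)) ∧
      LipschitzOnWith 2 g (tangentProj Γ y '' (Metric.ball y δ ∩ Γ))

/-- `M` is the minimal number of balls of radius `r` with centers in `Γ` that cover `Γ`. -/
def IsMinimalCover {D : ℕ} (Γ : Set (EuclideanSpace ℝ (Fin D))) (r : ℝ) (M : ℕ) : Prop :=
  IsLeast {n : ℕ | ∃ y : Fin n → EuclideanSpace ℝ (Fin D),
    (∀ i, y i ∈ Γ) ∧ Γ ⊆ ⋃ i, Metric.ball (y i) r} M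

/-- `η` is a Gaussian random vector in `ℝ^D` with mean zero and covariance matrix `σ² I`: its
components are independent and have law `N(0, σ²)`. -/
def IsGaussianNoise {Ω : Type*} [MeasurableSpace Ω] (P : Measure Ω) {D : ℕ} (σ : ℝ≥0)
    (η : Ω → EuclideanSpace ℝ (Fin D)) : Prop :=
  iIndepFun (fun (i : Fin D) (s : Ω) => η s i) P ∧
    ∀ i : Fin D, HasLaw (fun s => η s i) (gaussianReal 0 (σ ^ 2)) P

end

/-! Existence of a radius: in a chart, the difference of two nearby points of the ambient
submanifold is, up to a small relative error, a tangent vector at any nearby base point, so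
tangential projection shortens it by at most a factor 2 (`exists_ball_norm_sub_le`). A Lebesgue
number makes the radius uniform on the compact set, and the inverse function theorem gives openness
of the image and smoothness of the inverse (`exists_local_inverse`).

The network averages a random choice. Each covering ball has tangential coordinates `Q i (x - y i)`
in dimension `d`. Draw `t` uniformly from `[0,1)`. Cumulative bump functions cut `[0,1)` into
intervals, and the one containing `t` selects a patch `i`; the same `t` shifts the rescaled
coordinates along the diagonal, and their integer parts select a grid cell `k`. The output is the
mean of values `w (i, k)` in the cube. The times selecting `(i, k)` form an interval whose length is
a rectified combination of two minima of rectified affine functionals (`volume_real_cellTimes`), so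
a ReLU network of depth about `log d` and size depending on `d` only computes it. These lengths are
a partition of unity near `Γ`, so the output is a convex combination. A one-point Kirszbraun
extension chooses `w (i, k)` compatible with `f` on the whole patch, even when no point of `Γ` has
the grid point as its coordinates. The number of cells is linear in `M`, better than `M ^ (d + 1)`;
the weights computing the features go into `K₂`.

For stability, the values active at `x + v` are compared with `f x`. The error is at most `2 * C * B
+ ε / 2`, where `B` bounds all `‖Q i v‖`: only tangential noise counts, uniformly in `x`. The
supremum over `Γ` thus reduces to a maximum of `M` squared norms of `d`-dimensional Gaussian
vectors, controlled by exponential moments (`lintegral_max_norm_sq_le`). Large noise is paid for by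
a Gaussian tail, since the output stays in the cube. -/

/-! ### Sparse affine maps, ReLU layers and their composition -/

/-- `ℓ` is an affine functional with at most `w` nonzero coefficients (constant term included). -/
def IsSparseAffine {ι : Type} [Fintype ι] (w : ℕ) (ℓ : (ι → ℝ) → ℝ) : Prop :=
  ∃ (a : ι → ℝ) (b : ℝ), {j | a j ≠ 0}.ncard + (if b = 0 then 0 else 1) ≤ w ∧
    ∀ x, ℓ x = ∑ j, a j * x j + b

namespace IsSparseAffine

variable {ι κ : Type} [Fintype ι] [Fintype κ] {w w' : ℕ} {ℓ ℓ' : (ι → ℝ) → ℝ}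

theorem mono (h : IsSparseAffine w ℓ) (hw : w ≤ w') : IsSparseAffine w' ℓ := by
  obtain ⟨a, b, hab, hℓ⟩ := h
  exact ⟨a, b, hab.trans hw, hℓ⟩

theorem congr (h : IsSparseAffine w ℓ) (he : ∀ x, ℓ' x = ℓ x) : IsSparseAffine w ℓ' := by
  rwa [funext he]

theorem const (c : ℝ) : IsSparseAffine 1 (fun _ : ι → ℝ => c) :=
  ⟨0, c, by simp; split_ifs <;> simp, by simp⟩

theorem zero : IsSparseAffine 0 (fun _ : ι → ℝ => 0) := ⟨0, 0, by simp, by simp⟩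

theorem coord (j : ι) : IsSparseAffine 1 (fun x : ι → ℝ => x j) := by
  classical
  refine ⟨Pi.single j 1, 0, ?_, fun x => ?_⟩
  · have : {i | (Pi.single j 1 : ι → ℝ) i ≠ 0} ⊆ {j} := by
      intro i hi
      by_contra h
      exact hi (Pi.single_eq_of_ne (by simpa using h) 1)
    simpa using Set.ncard_le_ncard this
  · simp [Pi.single_apply]

theorem add (h : IsSparseAffine w ℓ) (h' : IsSparseAffine w' ℓ') :
    IsSparseAffine (w + w') (fun x => ℓ x + ℓ' x) := by
  obtain ⟨a, b, hab, hℓ⟩ := h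
  obtain ⟨a', b', hab', hℓ'⟩ := h'
  refine ⟨a + a', b + b', ?_, fun x => ?_⟩
  · have h1 : {j | (a + a') j ≠ 0} ⊆ {j | a j ≠ 0} ∪ {j | a' j ≠ 0} := by
      intro j hj
      by_contra h
      simp only [Set.mem_union, Set.mem_ofPred_eq, not_or, not_not] at h
      exact hj (by simp [h.1, h.2])
    have h2 := (Set.ncard_le_ncard h1).trans (Set.ncard_union_le _ _)
    have h3 : (if b + b' = 0 then 0 else 1) ≤ (if b = 0 then 0 else 1) + if b' = 0 then 0 else 1 := by
      by_cases hb : b = 0 <;> by_cases hb' : b' = 0 <;> simp [hb, hb']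
      split_ifs <;> simp
    omega
  · simp only [hℓ, hℓ', Pi.add_apply, add_mul, Finset.sum_add_distrib]
    ring

theorem const_mul (h : IsSparseAffine w ℓ) (c : ℝ) : IsSparseAffine w (fun x => c * ℓ x) := by
  obtain ⟨a, b, hab, hℓ⟩ := h
  refine ⟨fun j => c * a j, c * b, le_trans ?_ hab, fun x => ?_⟩
  · refine Nat.add_le_add (Set.ncard_le_ncard fun j hj => ?_) ?_
    · exact fun h => hj (by simp [h])
    · by_cases hb : b = 0 <;> simp [hb]
      split_ifs <;> simp
  · simp only [hℓ, mul_add, Finset.mul_sum, mul_assoc]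

theorem sub (h : IsSparseAffine w ℓ) (h' : IsSparseAffine w' ℓ') :
    IsSparseAffine (w + w') (fun x => ℓ x - ℓ' x) :=
  (h.add (h'.const_mul (-1))).congr fun x => by ring

theorem sum {J : Type} (s : Finset J) {w : J → ℕ} {ℓ : J → (ι → ℝ) → ℝ}
    (h : ∀ i ∈ s, IsSparseAffine (w i) (ℓ i)) :
    IsSparseAffine (∑ i ∈ s, w i) (fun x => ∑ i ∈ s, ℓ i x) := by
  classical
  induction s using Finset.induction_on with
  | empty => simpa using zero
  | insert i s hi ih =>
    simp only [Finset.sum_insert hi]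
    exact (h i (by simp)).add (ih fun j hj => h j (by simp [hj]))

theorem comp_injective (h : IsSparseAffine w ℓ) {e : ι → κ} (he : Function.Injective e) :
    IsSparseAffine w (fun x : κ → ℝ => ℓ (fun i => x (e i))) := by
  classical
  obtain ⟨a, b, hab, hℓ⟩ := h
  refine ⟨Function.extend e a 0, b, le_trans ?_ hab, fun x => ?_⟩
  · have : {j | Function.extend e a 0 j ≠ 0} ⊆ e '' {j | a j ≠ 0} := by
      intro j hj
      by_cases h : ∃ i, e i = j
      · obtain ⟨i, rfl⟩ := h
        exact ⟨i, by simpa [he.extend_apply] using hj, rfl⟩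
      · exact absurd (Function.extend_apply' a (0 : κ → ℝ) j h) hj
    have := (Set.ncard_le_ncard this).trans (Set.ncard_image_le (Set.toFinite _))
    omega
  · simp only [hℓ]
    congr 1
    rw [← Finset.sum_subset (Finset.subset_univ (Finset.univ.image e)),
      Finset.sum_image (fun _ _ _ _ h => he h)]
    · simp [he.extend_apply]
    · intro j _ hj
      rw [Function.extend_apply' _ _ _ (by simpa using hj)]
      simp

end IsSparseAffine

/-- `F` is a ReLU layer with at most `W` weights. -/
def IsReluLayer {ι κ : Type} [Fintype ι] [Fintype κ] (W : ℕ) (F : (ι → ℝ) → κ → ℝ) : Prop :=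
  ∃ w : κ → ℕ, ∑ k, w k ≤ W ∧
    ∀ k, ∃ ℓ : (ι → ℝ) → ℝ, IsSparseAffine (w k) ℓ ∧ ∀ x, F x k = max 0 (ℓ x)

/-- `F` is a composition of `L` ReLU layers with at most `W` weights in total. -/
inductive ReluStack : ℕ → ℕ → (ι κ : Type) → ((ι → ℝ) → κ → ℝ) → Prop
  | refl (ι : Type) : ReluStack 0 0 ι ι id
  | cons {L W w : ℕ} {ι μ κ : Type} [Fintype ι] [Fintype μ] [Nonempty μ]
      {G : (ι → ℝ) → μ → ℝ} {F : (μ → ℝ) → κ → ℝ} (hG : IsReluLayer w G)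
      (hF : ReluStack L W μ κ F) : ReluStack (L + 1) (w + W) ι κ (fun x => F (G x))

namespace ReluStack

variable {L L' W W' : ℕ} {ι μ κ : Type}

theorem trans {F : (ι → ℝ) → μ → ℝ} {G : (μ → ℝ) → κ → ℝ} (hF : ReluStack L W ι μ F)
    (hG : ReluStack L' W' μ κ G) : ReluStack (L + L') (W + W') ι κ (fun x => G (F x)) := by
  induction hF with
  | refl ι => simpa using hG
  | cons hA _ ih =>
    have := cons hA (ih hG)
    rwa [← add_assoc, show ∀ a b : ℕ, a + b + 1 = (a + 1) + b by intros; omega] at this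

theorem of_layer [Fintype ι] [Fintype κ] [Nonempty κ] {F : (ι → ℝ) → κ → ℝ}
    (hF : IsReluLayer W F) : ReluStack 1 W ι κ F :=
  cons hF (refl κ)

theorem exists_of_zero {F : (ι → ℝ) → κ → ℝ} (hF : ReluStack 0 W ι κ F) :
    W = 0 ∧ ∃ h : κ = ι, F = fun x k => x (cast h k) := by
  cases hF
  exact ⟨rfl, rfl, rfl⟩

theorem exists_of_succ {F : (ι → ℝ) → κ → ℝ} (hF : ReluStack (L + 1) W ι κ F) :
    ∃ (_ : Fintype ι) (μ : Type) (_ : Fintype μ) (_ : Nonempty μ) (w W' : ℕ)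
      (G : (ι → ℝ) → μ → ℝ) (H : (μ → ℝ) → κ → ℝ),
      IsReluLayer w G ∧ ReluStack L W' μ κ H ∧ w + W' = W ∧ F = fun x => H (G x) := by
  cases hF with
  | cons hG hF => exact ⟨_, _, _, inferInstance, _, _, _, _, hG, hF, rfl, rfl⟩

end ReluStack

theorem IsReluLayer.sigma {I : Type} [Fintype I] {μ : I → Type} [∀ i, Fintype (μ i)] {ι : Type}
    [Fintype ι] {W : I → ℕ} {F : ∀ i, (ι → ℝ) → μ i → ℝ} (h : ∀ i, IsReluLayer (W i) (F i)) :
    IsReluLayer (∑ i, W i) (fun x (p : Σ i, μ i) => F p.1 x p.2) := by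
  choose w hw hF using h
  refine ⟨fun p => w p.1 p.2, ?_, fun p => hF p.1 p.2⟩
  rw [Fintype.sum_sigma]
  exact Finset.sum_le_sum fun i _ => hw i

theorem IsReluLayer.comp_injective {ι ι' κ : Type} [Fintype ι] [Fintype ι'] [Fintype κ] {W : ℕ}
    {F : (ι → ℝ) → κ → ℝ} (h : IsReluLayer W F) {e : ι → ι'} (he : Function.Injective e) :
    IsReluLayer W (fun (x : ι' → ℝ) => F (fun i => x (e i))) := by
  obtain ⟨w, hw, hF⟩ := h
  refine ⟨w, hw, fun k => ?_⟩
  obtain ⟨ℓ, hℓ, h⟩ := hF k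
  exact ⟨_, hℓ.comp_injective he, fun x => h _⟩

namespace ReluStack

/-- Networks with the same number of layers run in parallel on separate inputs. -/
theorem sigmaMap {I : Type} [Fintype I] [Nonempty I] {L : ℕ} {W : I → ℕ} {ι κ : I → Type}
    {F : ∀ i, (ι i → ℝ) → κ i → ℝ} (h : ∀ i, ReluStack L (W i) (ι i) (κ i) (F i)) :
    ReluStack L (∑ i, W i) (Σ i, ι i) (Σ i, κ i)
      (fun x p => F p.1 (fun j => x ⟨p.1, j⟩) p.2) := by
  induction L generalizing W ι with
  | zero =>
    have h' := fun i => exists_of_zero (h i)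
    choose hW hκ hF using h'
    obtain rfl : κ = ι := funext hκ
    obtain rfl : W = 0 := funext hW
    obtain rfl : F = fun i x k => x k := funext hF
    rw [show ∑ i, (0 : I → ℕ) i = 0 by simp]
    exact refl (Σ i, κ i)
  | succ L ih =>
    have h' := fun i => exists_of_succ (h i)
    choose iι μ iμ nμ w W' G H hG hH hW hF using h'
    obtain rfl : (fun i => w i + W' i) = W := funext hW
    obtain rfl : F = fun i x => H i (G i x) := funext hF
    rw [Finset.sum_add_distrib]
    have : Nonempty (Σ i, μ i) := ⟨⟨Classical.arbitrary I, Classical.arbitrary _⟩⟩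
    refine cons (IsReluLayer.sigma fun i => (hG i).comp_injective (e := Sigma.mk i) ?_) (ih hH)
    exact sigma_mk_injective

/-- Networks with the same number of layers run in parallel on the same input. -/
theorem sigma {I : Type} [Fintype I] [Nonempty I] {L : ℕ} {W : I → ℕ} {ι : Type} {κ : I → Type}
    {F : ∀ i, (ι → ℝ) → κ i → ℝ} (h : ∀ i, ReluStack (L + 1) (W i) ι (κ i) (F i)) :
    ReluStack (L + 1) (∑ i, W i) ι (Σ i, κ i) (fun x p => F p.1 x p.2) := by
  have h' := fun i => exists_of_succ (h i)
  choose iι μ iμ nμ w W' G H hG hH hW hF using h'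
  obtain rfl : (fun i => w i + W' i) = W := funext hW
  obtain rfl : F = fun i x => H i (G i x) := funext hF
  rw [Finset.sum_add_distrib]
  have : Nonempty (Σ i, μ i) := ⟨⟨Classical.arbitrary I, Classical.arbitrary _⟩⟩
  let := iι (Classical.arbitrary I)
  refine cons (IsReluLayer.sigma (F := G) fun i => ?_) (sigmaMap hH)
  convert hG i

end ReluStack

theorem IsSparseAffine.exists_matrix {n m : ℕ} {w : Fin m → ℕ} {ℓ : Fin m → (Fin n → ℝ) → ℝ}
    (hℓ : ∀ j, IsSparseAffine (w j) (ℓ j)) :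
    ∃ (A : Matrix (Fin m) (Fin n) ℝ) (b : Fin m → ℝ),
      NeuralNetwork.layerWeights A b ≤ ∑ j, w j ∧ ∀ x j, (A.mulVec x + b) j = ℓ j x := by
  classical
  choose a b hab hℓ using hℓ
  refine ⟨a, b, le_trans ?_ (Finset.sum_le_sum fun j _ => hab j), fun x j => ?_⟩
  · rw [Finset.sum_add_distrib]
    refine Nat.add_le_add (le_of_eq ?_) (le_of_eq ?_)
    · simp [Set.ncard_eq_toFinset_card', Finset.card_filter, Fintype.sum_prod_type]
    · simp [Set.ncard_eq_toFinset_card', Finset.card_filter]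
  · rw [hℓ]
    simp [Matrix.mulVec, dotProduct]

namespace ReluStack

/-- A stack followed by an affine output layer is a neural network. -/
theorem exists_neuralNetwork [iκ : Fintype κ] {F : (ι → ℝ) → κ → ℝ} (hF : ReluStack L W ι κ F)
    {m : ℕ} {w : Fin m → ℕ} {ℓ : Fin m → (κ → ℝ) → ℝ} (hℓ : ∀ j, IsSparseAffine (w j) (ℓ j))
    {n : ℕ} (e : ι ≃ Fin n) :
    ∃ Φ : NeuralNetwork n m, Φ.depth = L + 1 ∧ Φ.weights ≤ W + ∑ j, w j ∧
      ∀ x j, Φ.eval x j = ℓ j (F (fun i => x (e i))) := by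
  revert iκ
  induction hF generalizing n with
  | refl ι =>
    intro _ hℓ
    obtain ⟨A, b, hW, hA⟩ := IsSparseAffine.exists_matrix
      (fun j => (hℓ j).comp_injective e.injective)
    exact ⟨.output A b, rfl, by simpa [NeuralNetwork.weights] using hW, hA⟩
  | @cons L W w' ι μ κ _ _ _ G F hG hF ih =>
    intro _ hℓ
    obtain ⟨Φ, hL, hW, hΦ⟩ := ih (Fintype.equivFin μ) hℓ
    obtain ⟨v, hv, hG⟩ := hG
    choose g hg hG using hG
    obtain ⟨A, b, hA, hAb⟩ := IsSparseAffine.exists_matrix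
      (fun j => (hg ((Fintype.equivFin μ).symm j)).comp_injective e.injective)
    refine ⟨.layer Fintype.card_pos A b Φ, by simp [NeuralNetwork.depth, hL], ?_, fun x j => ?_⟩
    · rw [(Fintype.equivFin μ).symm.sum_comp v] at hA
      simp only [NeuralNetwork.weights]
      omega
    · simp [NeuralNetwork.eval, hΦ, hAb, ← hG]

end ReluStack

/-! ### Networks for minima and for copying -/

/-- A layer is determined by one sparse affine functional per neuron. -/
theorem IsReluLayer.of_neurons {ι κ : Type} [Fintype ι] [Fintype κ] {w : κ → ℕ}
    {ℓ : κ → (ι → ℝ) → ℝ} (h : ∀ k, IsSparseAffine (w k) (ℓ k)) :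
    IsReluLayer (∑ k, w k) (fun x k => max 0 (ℓ k x)) :=
  ⟨w, le_rfl, fun k => ⟨ℓ k, h k, fun _ => rfl⟩⟩

/-- The minimum of `2 ^ n` rectified affine functionals, as the difference of the two outputs of a
network with `n + 1` layers. -/
theorem exists_reluStack_min_pow {ι : Type} [Fintype ι] {w : ℕ} (n : ℕ) :
    ∀ ℓ : ℕ → (ι → ℝ) → ℝ, (∀ j, IsSparseAffine w (ℓ j)) →
    ∃ (W : ℕ) (F : (ι → ℝ) → Fin 2 → ℝ), W + 6 ≤ (w + 6) * 2 ^ n ∧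
      ReluStack (n + 1) W ι (Fin 2) F ∧
      ∀ x t, t ≤ F x 0 - F x 1 ↔ ∀ j < 2 ^ n, t ≤ max 0 (ℓ j x) := by
  induction n with
  | zero =>
    intro ℓ hℓ
    have hl : ∀ k : Fin 2, IsSparseAffine (![w, 0] k) ((![ℓ 0, fun _ => 0] : Fin 2 → _) k) := by
      intro k
      fin_cases k
      · exact hℓ 0
      · exact .zero
    refine ⟨_, _, ?_, .of_layer (.of_neurons hl), fun x t => ?_⟩
    · simp
    · simp
  | succ n ih =>
    intro ℓ hℓ
    obtain ⟨W₁, F₁, hW₁, hF₁, h₁⟩ := ih ℓ hℓ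
    obtain ⟨W₂, F₂, hW₂, hF₂, h₂⟩ := ih (fun j => ℓ (2 ^ n + j)) fun j => hℓ _
    have hs := ReluStack.sigma (I := Bool) (F := fun i => cond i F₁ F₂) (W := fun i => cond i W₁ W₂)
      (κ := fun _ => Fin 2) (L := n) (ι := ι) (by rintro (_ | _) <;> assumption)
    have hv : ∀ i : Bool, IsSparseAffine 2
        (fun y : (Σ _ : Bool, Fin 2) → ℝ => y ⟨i, 0⟩ - y ⟨i, 1⟩) := fun i =>
      (IsSparseAffine.coord _).sub (.coord _)
    -- For `a ≥ 0`, `min a b = max 0 a - max 0 (a - b)`, so one layer of two neurons merges the two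
    -- halves.
    have hl : ∀ k : Fin 2, IsSparseAffine (![2, 4] k)
        ((![fun y => y ⟨true, 0⟩ - y ⟨true, 1⟩,
          fun y => (y ⟨true, 0⟩ - y ⟨true, 1⟩) - (y ⟨false, 0⟩ - y ⟨false, 1⟩)] :
          Fin 2 → ((Σ _ : Bool, Fin 2) → ℝ) → ℝ) k) := by
      intro k
      fin_cases k
      · exact hv true
      · exact (hv true).sub (hv false)
    refine ⟨_, _, ?_, hs.trans (.of_layer (.of_neurons hl)), fun x t => ?_⟩
    -- Merging costs `2 + 4 = 6` weights; the offset 6 in the claim turns the recursion into exact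
    -- doubling.
    · have : (w + 6) * 2 ^ (n + 1) = (w + 6) * 2 ^ n + (w + 6) * 2 ^ n := by ring
      simp only [Fintype.sum_bool, cond_true, cond_false, Fin.sum_univ_two, Matrix.cons_val_zero,
        Matrix.cons_val_one]
      omega
    · have e₁ : 0 ≤ F₁ x 0 - F₁ x 1 := (h₁ x 0).2 fun j _ => le_max_left _ _
      have : ∀ a b : ℝ, 0 ≤ a → max 0 a - max 0 (a - b) = min a b := by
        intro a b ha
        rcases le_total a b with h | h
        · rw [min_eq_left h, max_eq_right ha, max_eq_left (by linarith), sub_zero]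
        · rw [min_eq_right h, max_eq_right ha, max_eq_right (by linarith)]
          ring
      simp only [Matrix.cons_val_zero, Matrix.cons_val_one, cond_true, cond_false]
      rw [this _ _ e₁, le_min_iff, h₁, h₂]
      constructor
      · rintro ⟨ha, hb⟩ j hj
        rcases lt_or_ge j (2 ^ n) with h | h
        · exact ha j h
        · have := hb (j - 2 ^ n) (by rw [pow_succ] at hj; omega)
          rwa [Nat.add_sub_cancel' h] at this
      · refine fun h => ⟨fun j hj => h j (by rw [pow_succ]; omega), fun j hj =>
          h _ (by rw [pow_succ]; omega)⟩

/-- The minimum of a finite family of at most `2 ^ n` rectified affine functionals, as the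
difference of the two outputs of a network with `n + 1` layers. -/
theorem exists_reluStack_min {ι J : Type} [Fintype ι] [Fintype J] [Nonempty J] {w n : ℕ}
    (hn : Fintype.card J ≤ 2 ^ n) {ℓ : J → (ι → ℝ) → ℝ} (hℓ : ∀ j, IsSparseAffine w (ℓ j)) :
    ∃ (W : ℕ) (F : (ι → ℝ) → Fin 2 → ℝ), W ≤ (w + 6) * 2 ^ n ∧
      ReluStack (n + 1) W ι (Fin 2) F ∧
      ∀ x, F x 0 - F x 1 = Finset.univ.inf' Finset.univ_nonempty fun j => max 0 (ℓ j x) := by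
  let e := Fintype.equivFin J
  -- Padding to `2 ^ n` entries repeats a member of the family, which leaves the minimum unchanged.
  let s : ℕ → J := fun i => if h : i < Fintype.card J then e.symm ⟨i, h⟩ else Classical.arbitrary J
  obtain ⟨W, F, hW, hF, h⟩ := exists_reluStack_min_pow n (fun i => ℓ (s i)) fun i => hℓ _
  refine ⟨W, F, by omega, hF, fun x => eq_of_forall_le_iff fun t => ?_⟩
  rw [h, Finset.le_inf'_iff]
  refine ⟨fun hs j _ => ?_, fun hs i _ => hs _ (Finset.mem_univ _)⟩
  have := hs (e j) ((e j).2.trans_le hn)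
  simpa [s] using this

/-- `n` layers that copy nonnegative values. -/
theorem exists_reluStack_copy (κ : Type) [Fintype κ] [Nonempty κ] (n : ℕ) :
    ∃ (W : ℕ) (F : (κ → ℝ) → κ → ℝ), ReluStack n W κ κ F ∧ ∀ x, (∀ k, 0 ≤ x k) → F x = x := by
  induction n with
  | zero => exact ⟨_, _, .refl κ, fun x _ => rfl⟩
  | succ n ih =>
    obtain ⟨W, F, hF, h⟩ := ih
    refine ⟨_, _, hF.trans (.of_layer (.of_neurons fun k => .coord k)), fun x hx => ?_⟩
    simp [h x hx, hx]

/-! ### Tangent spaces and projection radii of submanifolds -/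

section Submanifold

open Filter Topology

variable {D d : ℕ}

/-- `e` is a chart of the `d`-dimensional submanifold `Γ`, with values in `S`. -/
structure IsSubmanifoldChart (d : ℕ) (Γ : Set (EuclideanSpace ℝ (Fin D)))
    (e : OpenPartialHomeomorph (EuclideanSpace ℝ (Fin D)) (EuclideanSpace ℝ (Fin D)))
    (S : Submodule ℝ (EuclideanSpace ℝ (Fin D))) : Prop where
  finrank_eq : Module.finrank ℝ S = d
  contDiffOn : ContDiffOn ℝ ∞ e e.source
  contDiffOn_symm : ContDiffOn ℝ ∞ e.symm e.target
  mem_iff : ∀ x ∈ e.source, x ∈ Γ ↔ e x ∈ S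

theorem IsSmoothSubmanifold.exists_chart {Γ : Set (EuclideanSpace ℝ (Fin D))}
    (h : IsSmoothSubmanifold d Γ) {y : EuclideanSpace ℝ (Fin D)} (hy : y ∈ Γ) :
    ∃ e S, y ∈ e.source ∧ IsSubmanifoldChart d Γ e S := by
  obtain ⟨e, S, h1, h2, h3, h4, h5⟩ := h y hy
  exact ⟨e, S, h1, h2, h3, h4, h5⟩

theorem Submodule.mem_of_hasDerivAt {E : Type*} [NormedAddCommGroup E] [InnerProductSpace ℝ E]
    [FiniteDimensional ℝ E] (S : Submodule ℝ E) {γ : ℝ → E} {v : E} (h : HasDerivAt γ v 0)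
    (hγ : ∀ᶠ t in 𝓝 0, γ t ∈ S) : v ∈ S := by
  have h1 : HasDerivAt (fun t => S.starProjection (γ t)) (S.starProjection v) 0 :=
    S.starProjection.hasFDerivAt.comp_hasDerivAt 0 h
  have h2 : HasDerivAt γ (S.starProjection v) 0 := h1.congr_of_eventuallyEq
    (hγ.mono fun t ht => (Submodule.starProjection_eq_self_iff.2 ht).symm)
  rw [h.unique h2]
  exact Submodule.starProjection_apply_mem _ _

namespace IsSubmanifoldChart

variable {Γ : Set (EuclideanSpace ℝ (Fin D))}
  {e : OpenPartialHomeomorph (EuclideanSpace ℝ (Fin D)) (EuclideanSpace ℝ (Fin D))}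
  {S : Submodule ℝ (EuclideanSpace ℝ (Fin D))} {y : EuclideanSpace ℝ (Fin D)}

theorem contDiffAt_symm (h : IsSubmanifoldChart d Γ e S) (hy : y ∈ e.source) :
    ContDiffAt ℝ ∞ e.symm (e y) :=
  h.contDiffOn_symm.contDiffAt (e.open_target.mem_nhds (e.map_source hy))

theorem hasFDerivAt_symm (h : IsSubmanifoldChart d Γ e S) (hy : y ∈ e.source) :
    HasFDerivAt e.symm (fderiv ℝ e.symm (e y)) (e y) :=
  ((h.contDiffAt_symm hy).differentiableAt (by simp)).hasFDerivAt

theorem hasFDerivAt (h : IsSubmanifoldChart d Γ e S) (hy : y ∈ e.source) :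
    HasFDerivAt e (fderiv ℝ e y) y :=
  ((h.contDiffOn.contDiffAt (e.open_source.mem_nhds hy)).differentiableAt (by simp)).hasFDerivAt

theorem fderiv_fderiv_symm (h : IsSubmanifoldChart d Γ e S) (hy : y ∈ e.source)
    (w : EuclideanSpace ℝ (Fin D)) : fderiv ℝ e y (fderiv ℝ e.symm (e y) w) = w := by
  have h1 : HasFDerivAt e (fderiv ℝ e y) (e.symm (e y)) := by
    rw [e.left_inv hy]; exact h.hasFDerivAt hy
  have h2 := h1.comp (e y) (h.hasFDerivAt_symm hy)
  have h3 := (hasFDerivAt_id (𝕜 := ℝ) (e y)).congr_of_eventuallyEq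
    (e.eventually_right_inverse (e.map_source hy))
  exact DFunLike.congr_fun (h2.unique h3) w

theorem fderiv_symm_fderiv (h : IsSubmanifoldChart d Γ e S) (hy : y ∈ e.source)
    (v : EuclideanSpace ℝ (Fin D)) : fderiv ℝ e.symm (e y) (fderiv ℝ e y v) = v := by
  have h2 := (h.hasFDerivAt_symm hy).comp y (h.hasFDerivAt hy)
  have h3 := (hasFDerivAt_id (𝕜 := ℝ) y).congr_of_eventuallyEq (e.eventually_left_inverse hy)
  exact DFunLike.congr_fun (h2.unique h3) v

theorem hasDerivAt_curve (h : IsSubmanifoldChart d Γ e S) (hy : y ∈ e.source)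
    (w : EuclideanSpace ℝ (Fin D)) :
    HasDerivAt (fun t : ℝ => e.symm (e y + t • w)) (fderiv ℝ e.symm (e y) w) 0 := by
  have h1 : HasDerivAt (fun t : ℝ => e y + t • w) w 0 := by
    simpa using ((hasDerivAt_id (0 : ℝ)).smul_const w).const_add (e y)
  have h2 : HasFDerivAt e.symm (fderiv ℝ e.symm (e y)) (e y + (0 : ℝ) • w) := by
    simpa using h.hasFDerivAt_symm hy
  exact h2.comp_hasDerivAt 0 h1

theorem eventually_curve_mem (h : IsSubmanifoldChart d Γ e S) (hy : y ∈ e.source) (hyΓ : y ∈ Γ)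
    {w : EuclideanSpace ℝ (Fin D)} (hw : w ∈ S) :
    ∀ᶠ t : ℝ in 𝓝 0, e.symm (e y + t • w) ∈ Γ := by
  have h1 : Tendsto (fun t : ℝ => e y + t • w) (𝓝 0) (𝓝 (e y)) :=
    Continuous.tendsto' (by fun_prop) _ _ (by simp)
  filter_upwards [h1 (e.open_target.mem_nhds (e.map_source hy))] with t ht
  rw [h.mem_iff _ (e.map_target ht), e.right_inv ht]
  exact S.add_mem ((h.mem_iff y hy).1 hyΓ) (S.smul_mem t hw)

theorem tangentSpaceAt_eq (h : IsSubmanifoldChart d Γ e S) (hy : y ∈ e.source) (hyΓ : y ∈ Γ) :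
    tangentSpaceAt Γ y = S.map (fderiv ℝ e.symm (e y)).toLinearMap := by
  refine le_antisymm (Submodule.span_le.2 ?_) ?_
  · rintro v ⟨γ, rfl, hγ, hv⟩
    refine ⟨fderiv ℝ e (γ 0) v, ?_, h.fderiv_symm_fderiv hy v⟩
    refine S.mem_of_hasDerivAt ((h.hasFDerivAt hy).comp_hasDerivAt 0 hv) ?_
    filter_upwards [hγ, hv.continuousAt (e.open_source.mem_nhds hy)] with t ht ht'
    exact (h.mem_iff _ ht').1 ht
  · rintro _ ⟨w, hw, rfl⟩
    exact Submodule.subset_span ⟨_, by simp [e.left_inv hy], h.eventually_curve_mem hy hyΓ hw,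
      h.hasDerivAt_curve hy w⟩

theorem finrank_tangentSpaceAt (h : IsSubmanifoldChart d Γ e S) (hy : y ∈ e.source)
    (hyΓ : y ∈ Γ) : Module.finrank ℝ (tangentSpaceAt Γ y) = d := by
  rw [h.tangentSpaceAt_eq hy hyΓ, ← h.finrank_eq]
  exact (LinearEquiv.finrank_eq (Submodule.equivMapOfInjective _
    (Function.LeftInverse.injective (h.fderiv_fderiv_symm hy)) S)).symm

end IsSubmanifoldChart

theorem IsSmoothSubmanifold.finrank_tangentSpaceAt {Γ : Set (EuclideanSpace ℝ (Fin D))}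
    (h : IsSmoothSubmanifold d Γ) {y : EuclideanSpace ℝ (Fin D)} (hy : y ∈ Γ) :
    Module.finrank ℝ (tangentSpaceAt Γ y) = d := by
  obtain ⟨e, S, hye, he⟩ := h.exists_chart hy
  exact he.finrank_tangentSpaceAt hye hy

/-- Near a point of a submanifold, the projections onto the tangent spaces are bi-Lipschitz. -/
theorem IsSmoothSubmanifold.exists_ball_norm_sub_le {Γ : Set (EuclideanSpace ℝ (Fin D))}
    (h : IsSmoothSubmanifold d Γ) {p : EuclideanSpace ℝ (Fin D)} (hp : p ∈ Γ) :
    ∃ r > 0, ∀ x ∈ Metric.ball p r ∩ Γ, ∀ x' ∈ Metric.ball p r ∩ Γ, ∀ y ∈ Metric.ball p r ∩ Γ,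
      ‖x - x'‖ ≤ 2 * ‖tangentProj Γ y (x - x')‖ := by
  obtain ⟨e, S, hpe, he⟩ := h.exists_chart hp
  set L := fderiv ℝ e.symm (e p) with hL
  set K := ‖fderiv ℝ e p‖ + 1 with hK
  have hK0 : 0 < K := by positivity
  have hKL : ∀ w, ‖w‖ ≤ K * ‖L w‖ := fun w => by
    calc ‖w‖ = ‖fderiv ℝ e p (L w)‖ := by rw [he.fderiv_fderiv_symm hpe]
      _ ≤ ‖fderiv ℝ e p‖ * ‖L w‖ := ContinuousLinearMap.le_opNorm _ _
      _ ≤ K * ‖L w‖ := by gcongr; simp [hK]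
  -- With tolerance `1 / (10 K)` the two errors below are each at most `‖x - x'‖ / 9`; the final
  -- constant is then `9 / 5 < 2`.
  have hc : 0 < (10 * K)⁻¹ := by positivity
  have hs : HasStrictFDerivAt e.symm L (e p) :=
    (he.contDiffAt_symm hpe).hasStrictFDerivAt (by simp)
  have hcont : ContinuousAt (fderiv ℝ e.symm) (e p) :=
    (he.contDiffAt_symm hpe).continuousAt_fderiv (by simp)
  have h1 : ∀ᶠ q : _ × _ in 𝓝 (p, p), ‖e.symm (e q.1) - e.symm (e q.2) - L (e q.1 - e q.2)‖ ≤
      (10 * K)⁻¹ * ‖e q.1 - e q.2‖ := by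
    have hec := e.continuousAt hpe
    exact ((hec.fst' (y := p)).prodMk (hec.snd' (x := p))).tendsto.eventually
      (hs.isLittleO.bound hc)
  have h2 : ∀ᶠ y in 𝓝 p, ‖fderiv ℝ e.symm (e y) - L‖ ≤ (10 * K)⁻¹ :=
    ((e.continuousAt hpe).tendsto.eventually (hcont.eventually (Metric.closedBall_mem_nhds _ hc))).mono
      fun y hy => by simpa [dist_eq_norm] using hy
  rw [nhds_prod_eq] at h1
  obtain ⟨U, hU, hU'⟩ := (eventually_prod_self_iff (r := fun a b =>
    ‖e.symm (e a) - e.symm (e b) - L (e a - e b)‖ ≤ (10 * K)⁻¹ * ‖e a - e b‖)).1 h1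
  obtain ⟨r, hr, hball⟩ := Metric.eventually_nhds_iff_ball.1
    (((show ∀ᶠ x in 𝓝 p, x ∈ U from hU).and h2).and (e.open_source.mem_nhds hpe))
  refine ⟨r, hr, fun x hx x' hx' y hy => ?_⟩
  obtain ⟨⟨hxU, -⟩, hxe⟩ := hball x hx.1
  obtain ⟨⟨hxU', -⟩, hxe'⟩ := hball x' hx'.1
  obtain ⟨⟨-, hyL⟩, hye⟩ := hball y hy.1
  have hS : e x - e x' ∈ S := S.sub_mem ((he.mem_iff x hxe).1 hx.2) ((he.mem_iff x' hxe').1 hx'.2)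
  set w := e x - e x' with hw
  -- The derivative is taken at `y`, not at `p`, so that `τ` is tangent at `y` and fixed by the
  -- projection there.
  set τ := fderiv ℝ e.symm (e y) w with hτ
  have hτT : τ ∈ tangentSpaceAt Γ y := by
    rw [he.tangentSpaceAt_eq hye hy.2]
    exact ⟨w, hS, rfl⟩
  have e1 : ‖x - x' - L w‖ ≤ (10 * K)⁻¹ * ‖w‖ := by
    have := hU' x hxU x' hxU'
    rwa [e.left_inv hxe, e.left_inv hxe'] at this
  have e2 : ‖τ - L w‖ ≤ (10 * K)⁻¹ * ‖w‖ := by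
    calc ‖τ - L w‖ = ‖(fderiv ℝ e.symm (e y) - L) w‖ := by simp [hτ]
      _ ≤ _ := (ContinuousLinearMap.le_opNorm _ _).trans (by gcongr)
  have e3 : ‖L w‖ ≤ ‖x - x'‖ + (10 * K)⁻¹ * ‖w‖ := by
    have := norm_sub_norm_le (L w) (x - x')
    rw [norm_sub_rev (L w) (x - x')] at this
    linarith
  have e4 := hKL w
  have e5 : (10 * K)⁻¹ * ‖w‖ ≤ ‖x - x'‖ / 9 := by
    have : (10 * K)⁻¹ * ‖w‖ ≤ (10 * K)⁻¹ * (K * ‖L w‖) := by gcongr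
    have h10 : (10 * K)⁻¹ * (K * ‖L w‖) = ‖L w‖ / 10 := by field_simp
    linarith
  have e6 : ‖x - x' - τ‖ ≤ 2 / 9 * ‖x - x'‖ := by
    have := norm_sub_le (x - x' - L w) (τ - L w)
    rw [sub_sub_sub_cancel_right] at this
    linarith
  have e7 : ‖tangentProj Γ y τ‖ = ‖τ‖ := Submodule.norm_orthogonalProjectionOnto_apply _ hτT
  have e8 : ‖tangentProj Γ y (x - x' - τ)‖ ≤ ‖x - x' - τ‖ :=
    Submodule.norm_orthogonalProjectionOnto_apply_le _ _
  have e9 : ‖tangentProj Γ y τ‖ - ‖tangentProj Γ y (x - x')‖ ≤ ‖tangentProj Γ y (x - x' - τ)‖ := by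
    rw [map_sub _ (x - x') τ, norm_sub_rev (tangentProj Γ y (x - x'))]
    exact norm_sub_norm_le _ _
  have e10 : ‖x - x'‖ ≤ ‖τ‖ + ‖x - x' - τ‖ := by
    simpa using norm_add_le τ (x - x' - τ)
  linarith [norm_nonneg (x - x')]

/-- A bi-Lipschitz projection of an open piece of a submanifold has smooth local inverses. -/
theorem IsSmoothSubmanifold.exists_local_inverse {Γ O : Set (EuclideanSpace ℝ (Fin D))}
    (h : IsSmoothSubmanifold d Γ) {y x₀ : EuclideanSpace ℝ (Fin D)} (hy : y ∈ Γ) (hO : IsOpen O)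
    (hx₀ : x₀ ∈ O ∩ Γ)
    (hL : ∀ x ∈ O ∩ Γ, ∀ x' ∈ O ∩ Γ, ‖x - x'‖ ≤ 2 * ‖tangentProj Γ y (x - x')‖) :
    ∃ k : tangentSpaceAt Γ y → EuclideanSpace ℝ (Fin D),
      ContDiffAt ℝ ∞ k (tangentProj Γ y x₀) ∧
      ∀ᶠ t in 𝓝 (tangentProj Γ y x₀), k t ∈ O ∩ Γ ∧ tangentProj Γ y (k t) = t := by
  obtain ⟨e, S, hxe, he⟩ := h.exists_chart hx₀.2
  set P := tangentProj Γ y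
  set A : S →L[ℝ] tangentSpaceAt Γ y := (P ∘L fderiv ℝ e.symm (e x₀)) ∘L S.subtypeL with hA
  -- Difference quotients of a curve in `Γ` obey the bi-Lipschitz bound, hence so does its velocity:
  -- the projection kills no nonzero tangent vector at `x₀`. Equal dimensions then make `A`
  -- invertible.
  have hinj : Function.Injective A := by
    refine (injective_iff_map_eq_zero A).2 fun w hw => ?_
    set v := fderiv ℝ e.symm (e x₀) w with hv
    have hγ := he.hasDerivAt_curve hxe (w : EuclideanSpace ℝ (Fin D))
    have hγ0 : e.symm (e x₀ + (0 : ℝ) • (w : EuclideanSpace ℝ (Fin D))) = x₀ := by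
      simp [e.left_inv hxe]
    have hmem := he.eventually_curve_mem hxe hx₀.2 w.2
    have hmem' : ∀ᶠ t : ℝ in 𝓝 0, e.symm (e x₀ + t • (w : EuclideanSpace ℝ (Fin D))) ∈ O :=
      hγ.continuousAt.eventually_mem (hO.mem_nhds (by rw [hγ0]; exact hx₀.1))
    have hslope := hasDerivAt_iff_tendsto_slope.1 hγ
    have hle : ‖v‖ ≤ 2 * ‖P v‖ := by
      refine le_of_tendsto_of_tendsto hslope.norm
        (((P.continuous.tendsto _).comp hslope).norm.const_mul 2) ?_
      filter_upwards [nhdsWithin_le_nhds hmem, nhdsWithin_le_nhds hmem'] with t h1 h2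
      simp only [Function.comp_apply, slope, hγ0, vsub_eq_sub, map_smul, norm_smul]
      have := hL _ ⟨h2, h1⟩ _ hx₀
      calc _ ≤ ‖(t - 0)⁻¹‖ * (2 * _) := by gcongr
        _ = _ := by ring
    have hP : P v = 0 := hw
    rw [hP, norm_zero, mul_zero, norm_le_zero_iff] at hle
    have := he.fderiv_fderiv_symm hxe (w : EuclideanSpace ℝ (Fin D))
    rw [← hv, hle, map_zero] at this
    exact Subtype.ext this.symm
  have hfin : Module.finrank ℝ S = Module.finrank ℝ (tangentSpaceAt Γ y) := by
    rw [he.finrank_eq, h.finrank_tangentSpaceAt hy]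
  let A' : S ≃L[ℝ] tangentSpaceAt Γ y :=
    (LinearMap.linearEquivOfInjective A.toLinearMap hinj hfin).toContinuousLinearEquiv
  have hA' : (A' : S →L[ℝ] tangentSpaceAt Γ y) = A := by ext; rfl
  let a₀ : S := ⟨e x₀, (he.mem_iff x₀ hxe).1 hx₀.2⟩
  have hsymm : ContDiffAt ℝ ∞ (fun w : S => e.symm (w : EuclideanSpace ℝ (Fin D))) a₀ :=
    (he.contDiffAt_symm hxe).comp a₀ S.subtypeL.contDiff.contDiffAt
  have hf : ContDiffAt ℝ ∞ (fun w : S => P (e.symm (w : EuclideanSpace ℝ (Fin D)))) a₀ :=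
    P.contDiff.contDiffAt.comp a₀ hsymm
  have hf' : HasFDerivAt (fun w : S => P (e.symm (w : EuclideanSpace ℝ (Fin D))))
      (A' : S →L[ℝ] tangentSpaceAt Γ y) a₀ := by
    rw [hA', hA]
    exact HasFDerivAt.comp (g := fun v => P (e.symm v)) (f := S.subtypeL) a₀
      (P.hasFDerivAt.comp (e x₀) (he.hasFDerivAt_symm hxe)) S.subtypeL.hasFDerivAt
  have hne : (∞ : WithTop ℕ∞) ≠ 0 := by simp
  have hfa : P (e.symm (a₀ : EuclideanSpace ℝ (Fin D))) = P x₀ := by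
    simp [a₀, e.left_inv hxe]
  have hinv := hf.to_localInverse hf' hne
  have hval := hf.localInverse_apply_image hf' hne
  have hright := (hf.hasStrictFDerivAt' hf' hne).eventually_right_inverse
  rw [hfa] at hinv hval hright
  set k₀ := hf.localInverse hf' hne with hk₀
  refine ⟨fun t => e.symm (k₀ t), ?_, ?_⟩
  · exact ContDiffAt.comp (g := fun w : S => e.symm (w : EuclideanSpace ℝ (Fin D))) _
      (by rwa [hval]) hinv
  · have hc : ContinuousAt (fun t => (k₀ t : EuclideanSpace ℝ (Fin D))) (P x₀) :=
      continuous_subtype_val.continuousAt.comp hinv.continuousAt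
    have hc1 : ∀ᶠ t in 𝓝 (P x₀), (k₀ t : EuclideanSpace ℝ (Fin D)) ∈ e.target :=
      hc.eventually_mem (by rw [hval]; exact e.open_target.mem_nhds (e.map_source hxe))
    have hc2 : ∀ᶠ t in 𝓝 (P x₀), e.symm (k₀ t : EuclideanSpace ℝ (Fin D)) ∈ O := by
      have : ContinuousAt e.symm (k₀ (P x₀) : EuclideanSpace ℝ (Fin D)) := by
        rw [hval]; exact (he.contDiffAt_symm hxe).continuousAt
      refine ContinuousAt.eventually_mem (f := fun t => e.symm (k₀ t : EuclideanSpace ℝ (Fin D)))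
        (this.comp (f := fun t => (k₀ t : EuclideanSpace ℝ (Fin D))) hc) (hO.mem_nhds ?_)
      rw [hval]
      simpa [a₀, e.left_inv hxe] using hx₀.1
    filter_upwards [hc1, hc2, hright] with t h1 h2 h3
    refine ⟨⟨h2, ?_⟩, h3⟩
    rw [he.mem_iff _ (e.map_target h1), e.right_inv h1]
    exact (k₀ t).2

/-- Every submanifold inside a compact subset of a submanifold of the same dimension has a
projection radius. -/
theorem IsSmoothSubmanifold.exists_isProjectionRadius {Γ K Γ' : Set (EuclideanSpace ℝ (Fin D))}
    (h : IsSmoothSubmanifold d Γ) (h' : IsSmoothSubmanifold d Γ') (hK : IsCompact K)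
    (hΓK : Γ ⊆ K) (hKΓ : K ⊆ Γ') : ∃ δ : ℝ, 0 < δ ∧ IsProjectionRadius Γ δ := by
  -- One tangent space contains the other and both have dimension `d`.
  have hT : ∀ y ∈ Γ, tangentSpaceAt Γ y = tangentSpaceAt Γ' y := fun y hy => by
    refine Submodule.eq_of_le_of_finrank_eq (Submodule.span_mono ?_) ?_
    · rintro v ⟨γ, h0, hγ, hv⟩
      exact ⟨γ, h0, hγ.mono fun t ht => hKΓ (hΓK ht), hv⟩
    · rw [h.finrank_tangentSpaceAt hy, h'.finrank_tangentSpaceAt (hKΓ (hΓK hy))]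
  choose r hr hball using fun p : K => h'.exists_ball_norm_sub_le (hKΓ p.2)
  obtain ⟨δ, hδ, hcov⟩ := lebesgue_number_lemma_of_metric hK
    (c := fun p : K => Metric.ball (p : EuclideanSpace ℝ (Fin D)) (r p))
    (fun p => Metric.isOpen_ball)
    (fun p hp => Set.mem_iUnion.2 ⟨⟨p, hp⟩, Metric.mem_ball_self (hr _)⟩)
  refine ⟨δ, hδ, fun y hy => ?_⟩
  obtain ⟨p, hp⟩ := hcov y (hΓK hy)
  have hP : ∀ v, ‖tangentProj Γ y v‖ = ‖tangentProj Γ' y v‖ := fun v => by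
    have : ∀ T T' : Submodule ℝ (EuclideanSpace ℝ (Fin D)), T = T' →
        ‖T.orthogonalProjectionOnto v‖ = ‖T'.orthogonalProjectionOnto v‖ := by
      rintro _ _ rfl
      rfl
    exact this _ _ (hT y hy)
  have hL : ∀ x ∈ Metric.ball y δ ∩ Γ, ∀ x' ∈ Metric.ball y δ ∩ Γ,
      ‖x - x'‖ ≤ 2 * ‖tangentProj Γ y (x - x')‖ := fun x hx x' hx' => by
    have := hball p x ⟨hp hx.1, hKΓ (hΓK hx.2)⟩ x' ⟨hp hx'.1, hKΓ (hΓK hx'.2)⟩ y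
      ⟨hp (Metric.mem_ball_self hδ), hKΓ (hΓK hy)⟩
    rwa [hP]
  have hloc := fun x₀ hx₀ => h.exists_local_inverse hy Metric.isOpen_ball (x₀ := x₀) hx₀ hL
  refine ⟨isOpen_iff_mem_nhds.2 ?_, ?_⟩
  · rintro _ ⟨x₀, hx₀, rfl⟩
    obtain ⟨k, -, hk⟩ := hloc x₀ hx₀
    filter_upwards [hk] with t ht
    exact ⟨k t, ht.1, ht.2⟩
  have hinj : Set.InjOn (tangentProj Γ y) (Metric.ball y δ ∩ Γ) := fun x hx x' hx' hxx' => by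
    have := hL x hx x' hx'
    rw [map_sub, hxx', sub_self, norm_zero, mul_zero, norm_le_zero_iff, sub_eq_zero] at this
    exact this
  have hg := hinj.leftInvOn_invFunOn
  refine ⟨Function.invFunOn (tangentProj Γ y) (Metric.ball y δ ∩ Γ), hg, ?_, ?_⟩
  · rintro _ ⟨x₀, hx₀, rfl⟩
    obtain ⟨k, hk, hk'⟩ := hloc x₀ hx₀
    refine (hk.congr_of_eventuallyEq (hk'.mono fun t ht => ?_)).contDiffWithinAt
    conv_lhs => rw [← ht.2]
    exact hg ht.1
  · refine LipschitzOnWith.of_dist_le_mul ?_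
    rintro _ ⟨x, hx, rfl⟩ _ ⟨x', hx', rfl⟩
    rw [hg hx, hg hx', dist_eq_norm, dist_eq_norm, ← map_sub]
    exact hL x hx x' hx'

end Submanifold

/-! ### One-point Kirszbraun extension -/

section OnePointExtension

variable {E F ι : Type*} [NormedAddCommGroup E] [InnerProductSpace ℝ E] [NormedAddCommGroup F]
  [InnerProductSpace ℝ F]

/-- The bias-variance decomposition, with the variance written through pairwise distances. It lets a
hypothesis on pairwise distances be compared with distances to a point. -/
theorem sum_mul_norm_sub_sq (s : Finset ι) (w : ι → ℝ) (b : ι → F) (y : F)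
    (hw : ∑ i ∈ s, w i = 1) :
    ∑ i ∈ s, w i * ‖b i - y‖ ^ 2 =
      (∑ i ∈ s, ∑ j ∈ s, w i * w j * ‖b i - b j‖ ^ 2) / 2 + ‖∑ i ∈ s, w i • b i - y‖ ^ 2 := by
  have h1 : ∀ i j, w i * w j * ‖b i - b j‖ ^ 2 = w j * (w i * ‖b i - y‖ ^ 2)
      + w i * (w j * ‖b j - y‖ ^ 2) - 2 * inner ℝ (w i • (b i - y)) (w j • (b j - y)) := by
    intro i j
    rw [← sub_sub_sub_cancel_right (b i) (b j) y, norm_sub_sq_real, inner_smul_left,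
      inner_smul_right]
    simp
    ring
  have h2 : ∑ i ∈ s, w i • b i - y = ∑ i ∈ s, w i • (b i - y) := by
    simp [smul_sub, Finset.sum_sub_distrib, ← Finset.sum_smul, hw]
  have h3 : ‖∑ i ∈ s, w i • (b i - y)‖ ^ 2 =
      ∑ i ∈ s, ∑ j ∈ s, inner ℝ (w i • (b i - y)) (w j • (b j - y)) := by
    rw [← real_inner_self_eq_norm_sq, sum_inner]
    simp only [inner_sum]
  rw [h2, h3]
  simp only [h1, Finset.sum_sub_distrib, Finset.sum_add_distrib, ← Finset.mul_sum,
    ← Finset.sum_mul, hw, one_mul]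
  ring

/-- One-point Kirszbraun extension for finitely many points. -/
theorem exists_norm_sub_le_of_finite [Finite ι] {a : ι → E} {b : ι → F}
    (h : ∀ i j, ‖b i - b j‖ ≤ ‖a i - a j‖) (z : E) : ∃ y : F, ∀ i, ‖b i - y‖ ≤ ‖a i - z‖ := by
  classical
  cases nonempty_fintype ι
  rcases isEmpty_or_nonempty ι with hι | hι
  · exact ⟨0, fun i => isEmptyElim i⟩
  -- On the simplex this is the dual function: the minimum over `y` of `∑ i, w i * (‖b i - y‖ ^ 2 -
  -- ‖a i - z‖ ^ 2)`, attained at the weighted mean of the `b i`.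
  let φ : (ι → ℝ) → ℝ := fun w => ∑ i, w i * (‖b i‖ ^ 2 - ‖a i - z‖ ^ 2) - ‖∑ i, w i • b i‖ ^ 2
  have hφ : Continuous φ := by fun_prop
  obtain ⟨w, hw, hmax⟩ := (isCompact_stdSimplex ℝ ι).exists_isMaxOn
    ⟨_, single_mem_stdSimplex ℝ (Classical.arbitrary ι)⟩ hφ.continuousOn
  obtain ⟨hw0, hw1⟩ := hw
  set y := ∑ i, w i • b i with hy
  have hφw : φ w ≤ 0 := by
    have e1 := sum_mul_norm_sub_sq Finset.univ w b 0 hw1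
    have e2 := sum_mul_norm_sub_sq Finset.univ w a z hw1
    have e3 : ∑ i, ∑ j, w i * w j * ‖b i - b j‖ ^ 2 ≤ ∑ i, ∑ j, w i * w j * ‖a i - a j‖ ^ 2 :=
      Finset.sum_le_sum fun i _ => Finset.sum_le_sum fun j _ => by
        have := hw0 i
        have := hw0 j
        have := h i j
        gcongr
    simp only [sub_zero] at e1
    simp only [φ, mul_sub, Finset.sum_sub_distrib]
    nlinarith [sq_nonneg ‖∑ i, w i • a i - z‖]
  refine ⟨y, fun i => ?_⟩
  suffices ‖b i - y‖ ^ 2 - ‖a i - z‖ ^ 2 ≤ φ w from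
    pow_le_pow_iff_left₀ (norm_nonneg _) (norm_nonneg _) two_ne_zero |>.1 (by linarith)
  -- First-order optimality: moving the maximiser `w` by `t` towards the vertex `i` cannot increase
  -- `φ`; then let `t` tend to 0.
  have key : ∀ t : ℝ, 0 < t → t ≤ 1 →
      ‖b i - y‖ ^ 2 - ‖a i - z‖ ^ 2 - φ w ≤ t * ‖b i - y‖ ^ 2 := by
    intro t ht ht1
    have hmem : (fun j => (1 - t) * w j + t * (Pi.single i 1 : ι → ℝ) j) ∈ stdSimplex ℝ ι := by
      refine ⟨fun j => ?_, ?_⟩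
      · have := hw0 j
        have : 0 ≤ (Pi.single i 1 : ι → ℝ) j := (single_mem_stdSimplex ℝ i).1 j
        have : 0 ≤ 1 - t := by linarith
        positivity
      · simp [Finset.sum_add_distrib, ← Finset.mul_sum, hw1]
    have := hmax hmem
    have e : φ (fun j => (1 - t) * w j + t * (Pi.single i 1 : ι → ℝ) j) =
        φ w + t * (‖b i - y‖ ^ 2 - ‖a i - z‖ ^ 2 - φ w) - t ^ 2 * ‖b i - y‖ ^ 2 := by
      have hsum : ∑ j, ((1 - t) * w j + t * (Pi.single i 1 : ι → ℝ) j) • b j = y + t • (b i - y) := by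
        simp only [add_smul, Finset.sum_add_distrib, mul_smul, ← Finset.smul_sum, ← hy]
        simp [Pi.single_apply, ite_smul]
        module
      have hb : ‖b i‖ ^ 2 = ‖b i - y‖ ^ 2 + 2 * inner ℝ (b i - y) y + ‖y‖ ^ 2 := by
        rw [← norm_add_sq_real, sub_add_cancel]
      simp only [φ, hsum, ← hy, add_mul, Finset.sum_add_distrib, mul_assoc, ← Finset.mul_sum]
      rw [norm_add_sq_real, norm_smul, inner_smul_right, real_inner_comm, mul_pow, Real.norm_eq_abs,
        sq_abs]
      simp [Pi.single_apply]
      rw [hb]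
      ring
    simp only [Set.mem_ofPred_eq] at this
    rw [e] at this
    by_contra! hc
    nlinarith
  refine le_of_forall_pos_le_add fun δ hδ => ?_
  have hN : 0 ≤ ‖b i - y‖ ^ 2 := sq_nonneg _
  have := key (min 1 (δ / (‖b i - y‖ ^ 2 + 1))) (by positivity) (min_le_left _ _)
  have h2 : min 1 (δ / (‖b i - y‖ ^ 2 + 1)) * ‖b i - y‖ ^ 2 ≤ δ := by
    calc _ ≤ δ / (‖b i - y‖ ^ 2 + 1) * (‖b i - y‖ ^ 2 + 1) := by
          gcongr
          · exact min_le_right _ _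
          · linarith
      _ = δ := by field_simp
  linarith

/-- One-point Kirszbraun extension. -/
theorem exists_norm_sub_le [FiniteDimensional ℝ F] {a : ι → E} {b : ι → F}
    (h : ∀ i j, ‖b i - b j‖ ≤ ‖a i - a j‖) (z : E) : ∃ y : F, ∀ i, ‖b i - y‖ ≤ ‖a i - z‖ := by
  rcases isEmpty_or_nonempty ι with hι | hι
  · exact ⟨0, fun i => isEmptyElim i⟩
  have := FiniteDimensional.proper_real F
  let i₀ := Classical.arbitrary ι
  classical
  -- The ball around `b i₀` supplies compactness; adjoining `i₀` to each finite subfamily keeps the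
  -- point inside it.
  obtain ⟨y, -, hy⟩ := (isCompact_closedBall (b i₀) ‖a i₀ - z‖).inter_iInter_nonempty
    (fun i => Metric.closedBall (b i) ‖a i - z‖) (fun i => Metric.isClosed_closedBall) fun u => by
      obtain ⟨y, hy⟩ := exists_norm_sub_le_of_finite
        (a := fun i : (insert i₀ u : Finset ι) => a i) (b := fun i => b i) (fun i j => h i j) z
      have hy' : ∀ i ∈ insert i₀ u, y ∈ Metric.closedBall (b i) ‖a i - z‖ := fun i hi => by
        simpa [dist_eq_norm, norm_sub_rev] using hy ⟨i, hi⟩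
      exact ⟨y, hy' _ (by simp), Set.mem_iInter₂.2 fun i hi => hy' i (by simp [hi])⟩
  exact ⟨y, fun i => by
    simpa [dist_eq_norm, norm_sub_rev (b i)] using Set.mem_iInter.1 hy i⟩

/-- One-point Kirszbraun extension with values in the unit cube. -/
theorem exists_mem_unitCube_norm_sub_le {q : ℕ} {a : ι → E} {b : ι → EuclideanSpace ℝ (Fin q)}
    {L : ℝ} (hL : 0 < L) (hb : ∀ i, b i ∈ unitCube q)
    (h : ∀ i j, ‖b i - b j‖ ≤ L * ‖a i - a j‖) (z : E) :
    ∃ y ∈ unitCube q, ∀ i, ‖b i - y‖ ≤ L * ‖a i - z‖ := by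
  obtain ⟨y, hy⟩ := exists_norm_sub_le (a := fun i => L • a i) (b := b)
    (fun i j => by simpa [← smul_sub, norm_smul, abs_of_pos hL] using h i j) (L • z)
  -- Clamping each coordinate to `[0,1]` only brings it closer to those of `b i`, which already lie
  -- there.
  refine ⟨WithLp.toLp 2 fun j => max 0 (min 1 (y j)), fun j => by simp, fun i => ?_⟩
  refine le_trans ?_ (by simpa [← smul_sub, norm_smul, abs_of_pos hL] using hy i)
  rw [EuclideanSpace.norm_eq, EuclideanSpace.norm_eq]
  refine Real.sqrt_le_sqrt (Finset.sum_le_sum fun j _ => ?_)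
  have := hb i j
  simp only [PiLp.sub_apply, Real.norm_eq_abs]
  refine pow_le_pow_left₀ (abs_nonneg _) ?_ 2
  rcases le_total (y j) 0 with h0 | h0
  · rw [min_eq_right (by linarith), max_eq_left h0, abs_of_nonneg, abs_of_nonneg] <;> linarith
  · rcases le_total (y j) 1 with h1 | h1
    · rw [min_eq_right h1, max_eq_right h0]
    · rw [min_eq_left h1, max_eq_right zero_le_one, abs_of_nonpos, abs_of_nonpos] <;> linarith

end OnePointExtension

/-! ### Exponential moments and tails of Gaussian noise -/

section GaussianNoise

open Real

theorem lintegral_pi_prod {n : ℕ} (ν : Measure ℝ) [IsProbabilityMeasure ν] (f : Fin n → ℝ → ℝ≥0∞)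
    (hf : ∀ j, Measurable (f j)) :
    ∫⁻ x, ∏ j, f j (x j) ∂(Measure.pi fun _ : Fin n => ν) = ∏ j, ∫⁻ t, f j t ∂ν := by
  have h := iIndepFun_pi (μ := fun _ : Fin n => ν) (X := f) fun j => (hf j).aemeasurable
  rw [lintegral_prod_eq_prod_lintegral_of_indepFun Finset.univ _ h
    fun j => (hf j).comp (measurable_pi_apply j)]
  refine Finset.prod_congr rfl fun j _ => ?_
  exact (measurePreserving_eval (fun _ : Fin n => ν) j).lintegral_comp (hf j)

theorem lintegral_exp_mul_gaussianReal (v : ℝ≥0) (t : ℝ) :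
    ∫⁻ x, ENNReal.ofReal (exp (t * x)) ∂(gaussianReal 0 v) =
      ENNReal.ofReal (exp (v * t ^ 2 / 2)) := by
  rw [← ofReal_integral_eq_lintegral_ofReal (integrable_exp_mul_gaussianReal t)
    (ae_of_all _ fun x => (exp_pos _).le)]
  have := congr_fun (mgf_id_gaussianReal (μ := 0) (v := v)) t
  simp only [mgf, id_eq, zero_mul, zero_add] at this
  rw [this]

theorem lintegral_exp_sum_gaussianReal {n : ℕ} (v : ℝ≥0) (a : Fin n → ℝ) :
    ∫⁻ x, ENNReal.ofReal (exp (∑ j, a j * x j)) ∂(Measure.pi fun _ : Fin n => gaussianReal 0 v) =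
      ENNReal.ofReal (exp (v * (∑ j, a j ^ 2) / 2)) := by
  have h1 : ∀ x : Fin n → ℝ, ENNReal.ofReal (exp (∑ j, a j * x j)) =
      ∏ j, ENNReal.ofReal (exp (a j * x j)) := fun x => by
    rw [exp_sum, ENNReal.ofReal_prod_of_nonneg fun _ _ => (exp_pos _).le]
  simp only [h1]
  rw [lintegral_pi_prod _ (fun j t => ENNReal.ofReal (exp (a j * t))) fun j => by fun_prop]
  simp only [lintegral_exp_mul_gaussianReal]
  rw [← ENNReal.ofReal_prod_of_nonneg fun _ _ => (exp_pos _).le, ← exp_sum, Finset.mul_sum,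
    Finset.sum_div]

/-- The exact value is `√(5 / 2)`, and `5 / 2 ≤ e`. The exponent `3 / 10` is what makes this
comparison work. -/
theorem lintegral_exp_sq_gaussianReal_le :
    ∫⁻ x, ENNReal.ofReal (exp (3 / 10 * x ^ 2)) ∂(gaussianReal 0 1) ≤
      ENNReal.ofReal (exp (1 / 2)) := by
  rw [gaussianReal_of_var_ne_zero 0 one_ne_zero,
    lintegral_withDensity_eq_lintegral_mul _ (measurable_gaussianPDF 0 1) (by fun_prop)]
  have h1 : ∀ x : ℝ, (gaussianPDF 0 1 * fun x => ENNReal.ofReal (exp (3 / 10 * x ^ 2))) x =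
      ENNReal.ofReal ((√(2 * π))⁻¹ * exp (-(1 / 5) * x ^ 2)) := fun x => by
    rw [Pi.mul_apply, gaussianPDF, ← ENNReal.ofReal_mul (gaussianPDFReal_nonneg _ _ _),
      gaussianPDFReal, mul_assoc, ← exp_add]
    congr 2
    · simp
    · simp
      ring
  simp only [h1]
  rw [← ofReal_integral_eq_lintegral_ofReal
    ((integrable_exp_neg_mul_sq (by norm_num)).const_mul _) (ae_of_all _ fun x => by positivity),
    integral_const_mul, integral_gaussian]
  refine ENNReal.ofReal_le_ofReal ?_
  rw [← sqrt_inv, ← sqrt_mul (by positivity), show (2 * π)⁻¹ * (π / (1 / 5)) = 5 / 2 by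
    field_simp, sqrt_le_left (exp_pos _).le, ← exp_nat_mul]
  have := exp_one_gt_d9
  norm_num at this ⊢
  linarith

theorem lintegral_exp_sum_sq_le {d : ℕ} {s : ℝ} (hs : s ≤ 3 / 10) :
    ∫⁻ g, ENNReal.ofReal (exp (s * ∑ j, g j ^ 2)) ∂(Measure.pi fun _ : Fin d => gaussianReal 0 1) ≤
      ENNReal.ofReal (exp (d / 2)) := by
  calc _ ≤ ∫⁻ g : Fin d → ℝ, ∏ j, ENNReal.ofReal (exp (3 / 10 * g j ^ 2))
        ∂(Measure.pi fun _ : Fin d => gaussianReal 0 1) := by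
        refine lintegral_mono fun g => ?_
        rw [← ENNReal.ofReal_prod_of_nonneg fun _ _ => (exp_pos _).le, ← exp_sum,
          ← Finset.mul_sum]
        gcongr
    _ = ∏ _j : Fin d, ∫⁻ t, ENNReal.ofReal (exp (3 / 10 * t ^ 2)) ∂(gaussianReal 0 1) :=
        lintegral_pi_prod _ (fun _ t => ENNReal.ofReal (exp (3 / 10 * t ^ 2))) fun j => by fun_prop
    _ ≤ ∏ _j : Fin d, ENNReal.ofReal (exp (1 / 2)) :=
        Finset.prod_le_prod' fun _ _ => lintegral_exp_sq_gaussianReal_le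
    _ = _ := by
        rw [Finset.prod_const, Finset.card_fin, ← ENNReal.ofReal_pow (exp_pos _).le, ← exp_nat_mul]
        congr 2
        ring

variable {Ω : Type*} [MeasurableSpace Ω] {P : Measure Ω} {D d : ℕ}
  {σ : ℝ≥0} {η : Ω → EuclideanSpace ℝ (Fin D)}

namespace IsGaussianNoise

theorem hasLaw_pi (h : IsGaussianNoise P σ η) :
    HasLaw (fun s => (η s).ofLp) (Measure.pi fun _ : Fin D => gaussianReal 0 (σ ^ 2)) P :=
  h.1.hasLaw_pi h.2

theorem aemeasurable (h : IsGaussianNoise P σ η) : AEMeasurable η P :=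
  (WithLp.measurable_toLp 2 (Fin D → ℝ)).comp_aemeasurable h.hasLaw_pi.aemeasurable

/-- The exponential moment of the squared norm of a `d`-dimensional contraction of the noise. -/
theorem lintegral_exp_norm_sq_le [IsProbabilityMeasure P] (h : IsGaussianNoise P σ η) (hσ : 0 < σ)
    (Q : EuclideanSpace ℝ (Fin D) →L[ℝ] EuclideanSpace ℝ (Fin d)) (hQ : ‖Q‖ ≤ 1) :
    ∫⁻ s, ENNReal.ofReal (exp (3 / 10 / σ ^ 2 * ‖Q (η s)‖ ^ 2)) ∂P ≤
      ENNReal.ofReal (exp (d / 2)) := by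
  set c : ℝ := √(3 / 5) / σ with hc
  have hc2 : c ^ 2 = 3 / 5 / σ ^ 2 := by rw [hc, div_pow, sq_sqrt (by norm_num)]
  have hσ' : (0 : ℝ) < σ := hσ
  set γ := Measure.pi fun _ : Fin d => gaussianReal 0 1
  set ν := Measure.pi fun _ : Fin D => gaussianReal 0 (σ ^ 2)
  -- Linearisation by an auxiliary standard Gaussian `g`: `exp (c ^ 2 * ‖u‖ ^ 2 / 2)` is the mean of
  -- `exp (c * ⟨g, u⟩)`. After swapping integrals the noise enters linearly, and the adjoint of `Q`
  -- is again a contraction.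
  have hlin : ∀ s, ENNReal.ofReal (exp (3 / 10 / σ ^ 2 * ‖Q (η s)‖ ^ 2)) =
      ∫⁻ g, ENNReal.ofReal (exp (c * inner ℝ (WithLp.toLp 2 g) (Q (η s)))) ∂γ := fun s => by
    have := lintegral_exp_sum_gaussianReal 1 fun j => c * Q (η s) j
    simp only [NNReal.coe_one, one_mul, mul_pow, ← Finset.mul_sum, hc2] at this
    rw [EuclideanSpace.real_norm_sq_eq]
    convert this.symm using 3
    · ring_nf
    · simp only [PiLp.inner_apply, RCLike.inner_apply, conj_trivial, Finset.mul_sum]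
      congr 2
      exact Finset.sum_congr rfl fun j _ => by ring
  simp only [hlin]
  rw [h.hasLaw_pi.lintegral_comp (f := fun x => ∫⁻ g, ENNReal.ofReal
    (exp (c * inner ℝ (WithLp.toLp 2 g) (Q (WithLp.toLp 2 x)))) ∂γ) ?_]
  · rw [lintegral_lintegral_swap]
    · refine le_trans (lintegral_mono fun g => ?_) (lintegral_exp_sum_sq_le le_rfl)
      have h1 : ∀ x : Fin D → ℝ, c * inner ℝ (WithLp.toLp 2 g) (Q (WithLp.toLp 2 x)) =
          ∑ j, (c * Q.adjoint (WithLp.toLp 2 g) j) * x j := fun x => by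
        rw [← ContinuousLinearMap.adjoint_inner_left]
        simp only [PiLp.inner_apply, RCLike.inner_apply, conj_trivial, Finset.mul_sum]
        exact Finset.sum_congr rfl fun j _ => by ring
      simp only [h1, lintegral_exp_sum_gaussianReal]
      refine ENNReal.ofReal_le_ofReal (exp_le_exp.2 ?_)
      simp only [mul_pow, ← Finset.mul_sum, hc2, ← EuclideanSpace.real_norm_sq_eq]
      have h2 : ‖Q.adjoint (WithLp.toLp 2 g)‖ ≤ ‖(WithLp.toLp 2 g : EuclideanSpace ℝ (Fin d))‖ := by
        refine (ContinuousLinearMap.le_opNorm _ _).trans ?_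
        rw [LinearIsometryEquiv.norm_map]
        exact mul_le_of_le_one_left (norm_nonneg _) hQ
      calc _ = 3 / 10 * ‖Q.adjoint (WithLp.toLp 2 g)‖ ^ 2 := by
            push_cast
            field_simp
            ring
        _ ≤ _ := by gcongr
    · refine Measurable.aemeasurable ?_
      fun_prop
  · refine Measurable.aemeasurable (Measurable.lintegral_prod_right ?_)
    fun_prop

theorem integral_norm_sq (h : IsGaussianNoise P σ η) : ∫ s, ‖η s‖ ^ 2 ∂P = D * σ ^ 2 := by
  have h2 : ∀ j, ∫ s, η s j ^ 2 ∂P = σ ^ 2 := fun j => by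
    have h1 := (h.2 j).integral_comp (f := fun x => x ^ 2) (by fun_prop)
    have h3 := variance_fun_id_gaussianReal (μ := 0) (v := σ ^ 2)
    rw [variance_of_integral_eq_zero (by fun_prop) (by simp)] at h3
    simpa [Function.comp_def] using h1.trans h3
  have h3 : ∀ j, Integrable (fun s => η s j ^ 2) P := fun j => by
    have h1 := (memLp_id_gaussianReal (μ := 0) (v := σ ^ 2) 2).integrable_sq
    rw [← (h.2 j).map_eq] at h1
    exact h1.comp_aemeasurable (h.2 j).aemeasurable
  simp only [EuclideanSpace.real_norm_sq_eq]
  rw [integral_finsetSum _ fun j _ => h3 j]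
  simp [h2]

/-- The probability that some component of the noise is large. -/
theorem measure_exists_ge_le [IsProbabilityMeasure P] (h : IsGaussianNoise P σ η) {ρ : ℝ} (hρ : 0 ≤ ρ) :
    P {s | ∃ j, ρ ≤ |η s j|} ≤ ENNReal.ofReal (2 * D * exp (-(ρ ^ 2 / (2 * σ ^ 2)))) := by
  have hsub : ∀ j, HasSubgaussianMGF (fun s => η s j) (σ ^ 2) P := fun j => by
    rw [← HasSubgaussianMGF.id_map_iff (h.2 j).aemeasurable, (h.2 j).map_eq]
    exact ⟨integrable_exp_mul_gaussianReal, fun t => by simp [mgf_id_gaussianReal]⟩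
  have h1 : ∀ j, P {s | ρ ≤ |η s j|} ≤ ENNReal.ofReal (2 * exp (-(ρ ^ 2 / (2 * σ ^ 2)))) := by
    intro j
    have e1 := (hsub j).measure_ge_le hρ
    have e2 := (hsub j).neg.measure_ge_le hρ
    have e3 : {s | ρ ≤ |η s j|} ⊆ {s | ρ ≤ η s j} ∪ {s | ρ ≤ (-fun s => η s j) s} := by
      intro s hs
      exact le_abs.1 (Set.mem_ofPred_eq ▸ hs)
    refine (measure_mono e3).trans ((measure_union_le _ _).trans ?_)
    rw [← ofReal_measureReal, ← ofReal_measureReal, ← ENNReal.ofReal_add measureReal_nonneg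
      measureReal_nonneg]
    refine ENNReal.ofReal_le_ofReal ?_
    push_cast at e1 e2
    rw [neg_div] at e1 e2
    linarith
  have h2 : {s | ∃ j, ρ ≤ |η s j|} = ⋃ j, {s | ρ ≤ |η s j|} := by ext; simp
  rw [h2]
  refine (measure_iUnion_fintype_le _ _).trans ((Finset.sum_le_sum fun j _ => h1 j).trans ?_)
  rw [Finset.sum_const, Finset.card_fin, nsmul_eq_mul, ← ENNReal.ofReal_natCast,
    ← ENNReal.ofReal_mul (by positivity)]
  exact le_of_eq (by congr 1; ring)

/-- The expected maximum of the squared norms of `M` `d`-dimensional contractions of the noise. -/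
theorem lintegral_max_norm_sq_le [IsProbabilityMeasure P] (h : IsGaussianNoise P σ η) (hσ : 0 < σ) {M : ℕ} (hM : 0 < M)
    (Q : Fin M → EuclideanSpace ℝ (Fin D) →L[ℝ] EuclideanSpace ℝ (Fin d)) (hQ : ∀ i, ‖Q i‖ ≤ 1)
    {X : Ω → ℝ} (hX : ∀ s, ∃ i, X s = ‖Q i (η s)‖ ^ 2) {c : ℝ} (hc : 0 ≤ c) :
    ∫⁻ s, ENNReal.ofReal (c * X s) ∂P ≤
      ENNReal.ofReal (c * (10 / 3 * σ ^ 2 * (log M + d / 2))) := by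
  have hσ' : (0 : ℝ) < σ := hσ
  -- This normalisation bounds the mean of `Y` by 1.
  set a : ℝ := M * exp (d / 2) with ha
  have ha0 : 0 < a := by positivity
  have hla : log a = log M + d / 2 := by
    rw [ha, log_mul (by positivity) (exp_pos _).ne', log_exp]
  let Y : Ω → ℝ := fun s => (∑ i, exp (3 / 10 / σ ^ 2 * ‖Q i (η s)‖ ^ 2)) / a
  have hmeas : ∀ i, AEMeasurable (fun s => exp (3 / 10 / σ ^ 2 * ‖Q i (η s)‖ ^ 2)) P := fun i => by
    have := h.aemeasurable
    fun_prop
  have hint : ∀ i, Integrable (fun s => exp (3 / 10 / σ ^ 2 * ‖Q i (η s)‖ ^ 2)) P := fun i => by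
    refine ⟨(hmeas i).aestronglyMeasurable, ?_⟩
    rw [hasFiniteIntegral_iff_ofReal (ae_of_all _ fun s => (exp_pos _).le)]
    exact (h.lintegral_exp_norm_sq_le hσ (Q i) (hQ i)).trans_lt ENNReal.ofReal_lt_top
  have hY : Integrable Y P := (integrable_finsetSum _ fun i _ => hint i).div_const a
  have hYle : ∫ s, Y s ∂P ≤ 1 := by
    simp only [Y, integral_div]
    rw [integral_finsetSum _ fun i _ => hint i, div_le_one ha0]
    calc _ ≤ ∑ _i : Fin M, exp (d / 2) := Finset.sum_le_sum fun i _ => by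
          rw [← ENNReal.ofReal_le_ofReal_iff (exp_pos _).le, ofReal_integral_eq_lintegral_ofReal
            (hint i) (ae_of_all _ fun s => (exp_pos _).le)]
          exact h.lintegral_exp_norm_sq_le hσ (Q i) (hQ i)
      _ = a := by simp [ha]
  -- The tangent-line bound `u ≤ log a - 1 + exp u / a` replaces Jensen's inequality; the maximum of
  -- the exponentials is at most their sum. No measurability of `X` is needed.
  have hXY : ∀ s, X s ≤ 10 / 3 * σ ^ 2 * (log a - 1 + Y s) := fun s => by
    obtain ⟨i, hi⟩ := hX s
    set u := 3 / 10 / (σ : ℝ) ^ 2 * ‖Q i (η s)‖ ^ 2 with hu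
    have e1 : exp u / a ≤ Y s := by
      refine div_le_div_of_nonneg_right ?_ ha0.le
      exact Finset.single_le_sum (f := fun i => exp (3 / 10 / (σ : ℝ) ^ 2 * ‖Q i (η s)‖ ^ 2))
        (fun _ _ => (exp_pos _).le) (Finset.mem_univ i)
    have e2 : u - log a + 1 ≤ exp u / a := by
      have := add_one_le_exp (u - log a)
      rwa [exp_sub, exp_log ha0] at this
    rw [hi]
    calc ‖Q i (η s)‖ ^ 2 = 10 / 3 * σ ^ 2 * u := by rw [hu]; field_simp
      _ ≤ _ := by gcongr; linarith
  have hX0 : ∀ s, 0 ≤ X s := fun s => by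
    obtain ⟨i, hi⟩ := hX s
    rw [hi]
    positivity
  calc ∫⁻ s, ENNReal.ofReal (c * X s) ∂P
      ≤ ∫⁻ s, ENNReal.ofReal (c * (10 / 3 * σ ^ 2 * (log a - 1 + Y s))) ∂P :=
        lintegral_mono fun s => ENNReal.ofReal_le_ofReal (by gcongr; exact hXY s)
    _ = ENNReal.ofReal (∫ s, c * (10 / 3 * σ ^ 2 * (log a - 1 + Y s)) ∂P) :=
        (ofReal_integral_eq_lintegral_ofReal
          ((((integrable_const _).add hY).const_mul _).const_mul _)
          (ae_of_all _ fun s => mul_nonneg hc ((hX0 s).trans (hXY s)))).symm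
    _ ≤ _ := by
        refine ENNReal.ofReal_le_ofReal ?_
        rw [integral_const_mul, integral_const_mul, integral_add (integrable_const _) hY,
          ← hla]
        simp only [integral_const, probReal_univ, smul_eq_mul, one_mul]
        gcongr
        linarith

end IsGaussianNoise

end GaussianNoise

/-! ### Bump functions and tangential coordinates as network features -/

section Features

variable {D d M : ℕ}

/-- Finitely many directions that detect the norm up to a factor `2`. -/
theorem exists_finset_norm_le_inner (D : ℕ) : ∃ U : Finset (EuclideanSpace ℝ (Fin D)),
    (∀ u ∈ U, ‖u‖ ≤ 1) ∧ ∀ v, ∃ u ∈ U, ‖v‖ ≤ 2 * inner ℝ u v := by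
  classical
  obtain ⟨t, ht, htf, hcov⟩ :=
    (isCompact_sphere (0 : EuclideanSpace ℝ (Fin D)) 1).finite_cover_balls one_half_pos
  refine ⟨insert 0 htf.toFinset, fun u hu => ?_, fun v => ?_⟩
  · rcases Finset.mem_insert.1 hu with rfl | hu
    · simp
    · exact (mem_sphere_zero_iff_norm.1 (ht (htf.mem_toFinset.1 hu))).le
  · rcases eq_or_ne v 0 with rfl | hv
    · exact ⟨0, by simp⟩
    have hv' : 0 < ‖v‖ := norm_pos_iff.2 hv
    have hn : ‖‖v‖⁻¹ • v‖ = 1 := norm_smul_inv_norm (𝕜 := ℝ) hv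
    obtain ⟨u, hu, hvu⟩ := Set.mem_iUnion₂.1 (hcov (mem_sphere_zero_iff_norm.2 hn))
    refine ⟨u, by simp [hu], ?_⟩
    have h1 : ‖u‖ = 1 := mem_sphere_zero_iff_norm.1 (ht hu)
    rw [mem_ball_iff_norm] at hvu
    have h2 := norm_sub_sq_real (‖v‖⁻¹ • v) u
    rw [hn, h1, real_inner_smul_left, real_inner_comm] at h2
    have h3 : ‖‖v‖⁻¹ • v - u‖ ^ 2 ≤ (1 / 2) ^ 2 := by gcongr
    have h4 : 1 ≤ 2 * (‖v‖⁻¹ * inner ℝ u v) := by linarith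
    calc ‖v‖ = ‖v‖ * 1 := (mul_one _).symm
      _ ≤ ‖v‖ * (2 * (‖v‖⁻¹ * inner ℝ u v)) := by gcongr
      _ = 2 * inner ℝ u v := by field_simp

/-- A family of neurons with some number of weights forms a layer. -/
theorem ReluStack.exists_of_neurons {ι κ : Type} [Fintype ι] [Fintype κ] [Nonempty κ]
    {ℓ : κ → (ι → ℝ) → ℝ} (h : ∀ k, ∃ w, IsSparseAffine w (ℓ k)) :
    ∃ W, ReluStack 1 W ι κ (fun x k => max 0 (ℓ k x)) := by
  choose w hw using h
  exact ⟨_, .of_layer (.of_neurons hw)⟩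

/-- The features computed by the first layers: `M + 1` cumulative bump functions and the positive
and negative parts of `M` vectors in `ℝ^d`. -/
abbrev Features (M d : ℕ) : Type := Fin (M + 1) ⊕ (Fin M × Fin d × Bool)

/-- The cumulative bump functions and linear coordinates attached to `M` balls are computed by a
network. -/
theorem exists_reluStack_features (y : Fin M → EuclideanSpace ℝ (Fin D)) (hD : 1 ≤ D)
    (hd : 1 ≤ d) (hM : 0 < M)
    (Q : Fin M → EuclideanSpace ℝ (Fin D) →L[ℝ] EuclideanSpace ℝ (Fin d)) {δ : ℝ}
    (hδ : 0 < δ) (n : ℕ) :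
    ∃ (W : ℕ) (F : (Fin D → ℝ) → Features M d → ℝ)
      (Φ : EuclideanSpace ℝ (Fin D) → Fin (M + 1) → ℝ),
      ReluStack (n + 4) W (Fin D) (Features M d) F ∧
      (∀ x i, F x.ofLp (.inl i) = 1 - Φ x i) ∧
      (∀ x i j, F x.ofLp (.inr (i, j, true)) - F x.ofLp (.inr (i, j, false)) = Q i (x - y i) j) ∧
      (∀ x, Φ x 0 = 0) ∧ (∀ x, Monotone (Φ x)) ∧ (∀ x i, Φ x i ≤ 1) ∧
      (∀ x i, Φ x i.castSucc < Φ x i.succ → ‖x - y i‖ < 5 / 6 * δ) ∧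
      ∀ x i, ‖x - y i‖ ≤ δ / 3 → Φ x (Fin.last M) = 1 := by
  classical
  obtain ⟨U, hU1, hU⟩ := exists_finset_norm_le_inner D
  have : Nonempty (Fin D) := ⟨⟨0, hD⟩⟩
  let p₀ : Fin M × Fin d × Bool := (⟨0, hM⟩, ⟨0, hd⟩, true)
  let sgn : Bool → ℝ := fun s => cond s 1 (-1)
  let diff : (Fin D × Bool → ℝ) → EuclideanSpace ℝ (Fin D) := fun x =>
    WithLp.toLp 2 fun j => x (j, true) - x (j, false)
  have haff : ∀ (g : EuclideanSpace ℝ (Fin D) →L[ℝ] ℝ) (c : ℝ), ∃ w, IsSparseAffine w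
      (fun x : Fin D × Bool → ℝ => g (diff x) + c) := fun g c => by
    refine ⟨_, ((IsSparseAffine.sum Finset.univ fun j _ =>
      ((IsSparseAffine.coord (j, true)).sub (.coord (j, false))).const_mul
        (g (EuclideanSpace.single j 1))).add (.const c)).congr fun x => ?_⟩
    have : diff x = ∑ j, (x (j, true) - x (j, false)) • EuclideanSpace.single j (1 : ℝ) := by
      ext l
      simp [diff, Finset.sum_apply, Pi.single_apply]
    rw [this, map_sum]
    simp [mul_comm]
  -- Inputs are split into positive and negative parts because copying layers preserve only
  -- nonnegative values. The `n` copying layers merely adjust the depth.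
  obtain ⟨W₀, h₀⟩ := ReluStack.exists_of_neurons (κ := Fin D × Bool)
    (ℓ := fun k (x : Fin D → ℝ) => sgn k.2 * x k.1)
    fun k => ⟨_, (IsSparseAffine.coord _).const_mul _⟩
  obtain ⟨W₁, F₁, h₁, hF₁⟩ := exists_reluStack_copy (Fin D × Bool) n
  have : Nonempty (Fin M × U ⊕ Fin M × Fin d × Bool) := ⟨.inr p₀⟩
  obtain ⟨W₂, h₂⟩ := ReluStack.exists_of_neurons (κ := Fin M × U ⊕ Fin M × Fin d × Bool)
    (ℓ := fun k (x : Fin D × Bool → ℝ) =>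
      Sum.elim (fun p : Fin M × U => innerSL ℝ (p.2 : EuclideanSpace ℝ (Fin D)))
        (fun p => sgn p.2.2 • (EuclideanSpace.proj p.2.1 ∘L Q p.1)) k (diff x) +
      Sum.elim (fun p : Fin M × U => -inner ℝ (p.2 : EuclideanSpace ℝ (Fin D)) (y p.1) - δ / 3)
        (fun p => -(sgn p.2.2 * Q p.1 (y p.1) p.2.1)) k) fun k => haff _ _
  have : Nonempty (Fin M ⊕ Fin M × Fin d × Bool) := ⟨.inr p₀⟩
  obtain ⟨W₃, h₃⟩ := ReluStack.exists_of_neurons (κ := Fin M ⊕ Fin M × Fin d × Bool)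
    (ℓ := Sum.elim (fun i (z : Fin M × U ⊕ Fin M × Fin d × Bool → ℝ) =>
        1 - ∑ u : U, 12 / δ * z (.inl (i, u)))
      (fun p z => z (.inr p))) (by
    rintro (i | p)
    · exact ⟨_, (IsSparseAffine.const 1).sub (.sum _ fun u _ => (IsSparseAffine.coord _).const_mul _)⟩
    · exact ⟨_, .coord _⟩)
  obtain ⟨W₄, h₄⟩ := ReluStack.exists_of_neurons (κ := Features M d)
    (ℓ := Sum.elim (fun i (z : Fin M ⊕ Fin M × Fin d × Bool → ℝ) =>
        1 - ∑ l : Fin M with l.castSucc < i, z (.inl l))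
      (fun p z => z (.inr p))) (by
    rintro (i | p)
    · exact ⟨_, (IsSparseAffine.const 1).sub (.sum _ fun u _ => .coord _)⟩
    · exact ⟨_, .coord _⟩)
  -- A piecewise linear bump: it is 1 within `δ / 3` of `y i` because `‖u‖ ≤ 1`, and vanishes once
  -- some `⟨u, x - y i⟩ ≥ δ / 3 + δ / 12`. As `U` detects norms up to a factor 2, its support lies
  -- within `5 / 6 * δ`.
  let β : EuclideanSpace ℝ (Fin D) → Fin M → ℝ := fun x i =>
    max 0 (1 - ∑ u : U, 12 / δ * max 0 (inner ℝ (u : EuclideanSpace ℝ (Fin D)) (x - y i) - δ / 3))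
  let s : EuclideanSpace ℝ (Fin D) → Fin (M + 1) → ℝ := fun x i =>
    ∑ l : Fin M with l.castSucc < i, β x l
  have hβ0 : ∀ x i, 0 ≤ β x i := fun x i => le_max_left _ _
  have hs : ∀ x, Monotone (s x) := fun x i i' hi => Finset.sum_le_sum_of_subset_of_nonneg
    (fun l hl => by
      simp only [Finset.mem_filter, Finset.mem_univ, true_and] at hl ⊢
      exact hl.trans_le hi) fun l _ _ => hβ0 x l
  have hstack := (((h₀.trans h₁).trans h₂).trans h₃).trans h₄
  rw [show 1 + n + 1 + 1 + 1 = n + 4 by omega] at hstack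
  have hcopy : ∀ x : EuclideanSpace ℝ (Fin D),
      diff (F₁ fun k => max 0 (sgn k.2 * x k.1)) = x := fun x => by
    rw [hF₁ _ fun k => le_max_left _ _]
    ext j
    rcases le_total (x j) 0 with h | h <;> simp [diff, sgn, h]
  refine ⟨_, _, fun x i => 1 - max 0 (1 - s x i), hstack, fun x i => ?_, fun x i j => ?_,
    fun x => ?_, fun x i i' hi => ?_, fun x i => ?_, fun x i hi => ?_, fun x i hi => ?_⟩
  · simp only [hcopy, Sum.elim_inl, s, β, sub_sub_cancel, innerSL_apply_apply, inner_sub_right]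
    congr! 8
    ring
  · simp only [hcopy, Sum.elim_inr, max_eq_right (le_max_left (0 : ℝ) _)]
    have hproj : ∀ v : EuclideanSpace ℝ (Fin d), EuclideanSpace.proj (𝕜 := ℝ) j v = v j :=
      fun _ => rfl
    simp only [sgn, cond_true, cond_false, smul_apply, ContinuousLinearMap.comp_apply, hproj,
      smul_eq_mul, map_sub, PiLp.sub_apply]
    rcases le_total (Q i x j - Q i (y i) j) 0 with h | h
    · rw [max_eq_left (by linarith), max_eq_right (by linarith)]
      ring
    · rw [max_eq_right (by linarith), max_eq_left (by linarith)]
      ring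
  · simp [s]
  · have := hs x hi
    simp only
    gcongr
  · simp
  · have hne : s x i.castSucc ≠ s x i.succ := fun h => by simp [h] at hi
    have hsplit : s x i.succ = β x i + s x i.castSucc := by
      simp only [s]
      rw [← Finset.sum_insert (by simp)]
      congr 1
      ext l
      simp [Fin.castSucc_lt_succ_iff, le_iff_eq_or_lt]
    have hβ : β x i ≠ 0 := fun h => hne (by rw [hsplit, h, zero_add])
    have hβpos : 0 < 1 - ∑ u : U,
        12 / δ * max 0 (inner ℝ (u : EuclideanSpace ℝ (Fin D)) (x - y i) - δ / 3) := by
      by_contra hc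
      exact hβ (max_eq_left (not_lt.1 hc))
    obtain ⟨u, huU, hu⟩ := hU (x - y i)
    have h1 := Finset.single_le_sum (f := fun u : U =>
      12 / δ * max 0 (inner ℝ (u : EuclideanSpace ℝ (Fin D)) (x - y i) - δ / 3))
      (fun u _ => by positivity) (Finset.mem_univ ⟨u, huU⟩)
    have h2 : 12 / δ * (inner ℝ u (x - y i) - δ / 3) < 1 :=
      lt_of_le_of_lt (mul_le_mul_of_nonneg_left (le_max_right _ _) (by positivity))
        (h1.trans_lt (sub_pos.1 hβpos))
    have h3 : inner ℝ u (x - y i) - δ / 3 < δ / 12 := by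
      rw [div_mul_eq_mul_div, div_lt_one hδ] at h2
      linarith
    linarith
  · have hβ1 : β x i = 1 := by
      have : ∀ u : U, 12 / δ * max 0 (inner ℝ (u : EuclideanSpace ℝ (Fin D)) (x - y i) - δ / 3) = 0 :=
        fun u => by
        have := (real_inner_le_norm (u : EuclideanSpace ℝ (Fin D)) (x - y i)).trans
          (mul_le_of_le_one_left (norm_nonneg _) (hU1 u u.2))
        rw [max_eq_left (by linarith), mul_zero]
      simp [β, this]
    have h1 : β x i ≤ s x (Fin.last M) :=
      Finset.single_le_sum (f := β x) (fun l _ => hβ0 x l) (by simp [Fin.castSucc_lt_last])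
    simp only
    rw [max_eq_left (by linarith), sub_zero]

end Features

/-! ### The partition of unity by cell times -/

section Cells

/-- The times `t ∈ [a, b)` for which `ζ + t` lies in the integer cell at `k`. -/
def cellTimes {d : ℕ} (a b : ℝ) (ζ : Fin d → ℝ) (k : Fin d → ℤ) : Set ℝ :=
  {t | (a ≤ t ∧ t < b) ∧ ∀ j, (k j : ℝ) ≤ ζ j + t ∧ ζ j + t < k j + 1}

/-- Every condition bounds `t` from above or from below, so the set is the interval `[1 - m₂, m₁)`.
Rectifying the terms of the minima changes nothing, because only times in `[0,1)` occur. -/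
theorem volume_real_cellTimes {d : ℕ} {a b : ℝ} (ha : 0 ≤ a) (ha1 : a ≤ 1) (hb0 : 0 ≤ b) (hb : b ≤ 1)
    (ζ : Fin d → ℝ) (k : Fin d → ℤ) :
    volume.real (cellTimes a b ζ k) = max 0
      (Finset.univ.inf' Finset.univ_nonempty (fun o : Option (Fin d) =>
          max 0 (o.elim b fun j => 1 + k j - ζ j)) +
        Finset.univ.inf' Finset.univ_nonempty (fun o : Option (Fin d) =>
          max 0 (o.elim (1 - a) fun j => 1 - k j + ζ j)) - 1) := by
  set m₁ := Finset.univ.inf' Finset.univ_nonempty (fun o : Option (Fin d) =>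
    max 0 (o.elim b fun j => 1 + k j - ζ j)) with hm₁
  set m₂ := Finset.univ.inf' Finset.univ_nonempty (fun o : Option (Fin d) =>
    max 0 (o.elim (1 - a) fun j => 1 - k j + ζ j)) with hm₂
  have hb1 : m₁ ≤ b := by
    have := Finset.inf'_le (fun o : Option (Fin d) =>
      max 0 (o.elim b fun j => 1 + k j - ζ j)) (Finset.mem_univ none)
    simpa [hb0] using this
  have ha2 : m₂ ≤ 1 - a := by
    have := Finset.inf'_le (fun o : Option (Fin d) =>
      max 0 (o.elim (1 - a) fun j => 1 - k j + ζ j)) (Finset.mem_univ none)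
    simpa [ha1] using this
  have h1 : ∀ t, 0 ≤ t → (t < m₁ ↔ t < b ∧ ∀ j, ζ j + t < k j + 1) := fun t ht => by
    rw [hm₁, Finset.lt_inf'_iff]
    simp only [Finset.mem_univ, true_imp_iff, Option.forall, lt_max_iff, not_lt.2 ht, false_or,
      Option.elim_none, Option.elim_some]
    refine and_congr_right fun _ => forall_congr' fun j => ?_
    constructor <;> intro h <;> linarith
  have h2 : ∀ t, t < 1 → (1 - m₂ ≤ t ↔ a ≤ t ∧ ∀ j, (k j : ℝ) ≤ ζ j + t) := fun t ht => by
    rw [sub_le_comm, hm₂, Finset.le_inf'_iff]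
    simp only [Finset.mem_univ, true_imp_iff, Option.forall, le_max_iff,
      not_le.2 (sub_pos.2 ht), false_or, Option.elim_none, Option.elim_some]
    refine and_congr (by constructor <;> intro h <;> linarith) (forall_congr' fun j => ?_)
    constructor <;> intro h <;> linarith
  have h3 : cellTimes a b ζ k = Set.Ico (1 - m₂) m₁ := by
    ext t
    constructor
    · rintro ⟨⟨hat, htb⟩, hk⟩
      exact ⟨(h2 t (by linarith)).2 ⟨hat, fun j => (hk j).1⟩,
        (h1 t (by linarith)).2 ⟨htb, fun j => (hk j).2⟩⟩
    · rintro ⟨ht1, ht2⟩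
      have e1 := (h2 t (by linarith)).1 ht1
      have e2 := (h1 t (by linarith)).1 ht2
      exact ⟨⟨e1.1, e2.1⟩, fun j => ⟨e1.2 j, e2.2 j⟩⟩
  rw [h3, Real.volume_real_Ico, max_comm]
  congr 1
  ring

variable {d M : ℕ}

/-- The volume of the cell times of a patch is computed by a network. -/
theorem exists_reluStack_cell (i : Fin M) (h : ℝ) (k : Fin d → ℤ) :
    ∃ (W : ℕ) (G : (Features M d → ℝ) → Unit → ℝ), W ≤ 36 * 2 ^ Nat.clog 2 d + 5 ∧
      ReluStack (Nat.clog 2 d + 3) W (Features M d) Unit G ∧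
      ∀ z, 0 ≤ z (.inl i.castSucc) → z (.inl i.castSucc) ≤ 1 → 0 ≤ z (.inl i.succ) →
        z (.inl i.succ) ≤ 1 →
        G z () = volume.real (cellTimes (1 - z (.inl i.castSucc)) (1 - z (.inl i.succ))
          (fun j => (z (.inr (i, j, true)) - z (.inr (i, j, false))) / h) k) := by
  -- Each minimum has `d + 1` terms: one per coordinate and one for the patch.
  have hcard : Fintype.card (Option (Fin d)) ≤ 2 ^ (Nat.clog 2 d + 1) := by
    have h1 := Nat.le_pow_clog one_lt_two d
    have h2 := Nat.one_le_two_pow (n := Nat.clog 2 d)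
    rw [Fintype.card_option, Fintype.card_fin, pow_succ]
    omega
  have hζ : ∀ j : Fin d, IsSparseAffine 2
      (fun z : Features M d → ℝ => h⁻¹ * (z (.inr (i, j, true)) - z (.inr (i, j, false)))) :=
    fun j => ((IsSparseAffine.coord _).sub (.coord _)).const_mul _
  obtain ⟨W₁, F₁, hW₁, hF₁, h₁⟩ := exists_reluStack_min hcard (w := 3) (ι := Features M d)
    (ℓ := fun o z => o.elim (1 - z (.inl i.succ)) fun j =>
      1 + k j - h⁻¹ * (z (.inr (i, j, true)) - z (.inr (i, j, false)))) (by
    rintro (_ | j)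
    · exact ((IsSparseAffine.const 1).sub (.coord _)).mono (by norm_num)
    · exact (IsSparseAffine.const _).sub (hζ j))
  obtain ⟨W₂, F₂, hW₂, hF₂, h₂⟩ := exists_reluStack_min hcard (w := 3) (ι := Features M d)
    (ℓ := fun o z => o.elim (z (.inl i.castSucc)) fun j =>
      1 - k j + h⁻¹ * (z (.inr (i, j, true)) - z (.inr (i, j, false)))) (by
    rintro (_ | j)
    · exact (IsSparseAffine.coord _).mono (by norm_num)
    · exact (IsSparseAffine.const _).add (hζ j))
  have hs := ReluStack.sigma (I := Bool) (F := fun i => cond i F₁ F₂) (W := fun i => cond i W₁ W₂)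
    (κ := fun _ => Fin 2) (ι := Features M d) (by rintro (_ | _) <;> assumption)
  have hl : ∀ _ : Unit, IsSparseAffine 5 (fun y : (Σ _ : Bool, Fin 2) → ℝ =>
      ((y ⟨true, 0⟩ - y ⟨true, 1⟩) + (y ⟨false, 0⟩ - y ⟨false, 1⟩)) - 1) := fun _ =>
    (((IsSparseAffine.coord _).sub (.coord _)).add ((IsSparseAffine.coord _).sub (.coord _))).sub
      (.const 1)
  refine ⟨_, _, ?_, hs.trans (.of_layer (.of_neurons hl)), fun z hz1 hz2 hz3 hz4 => ?_⟩
  · simp only [Fintype.sum_bool, cond_true, cond_false, Finset.univ_unique, Finset.sum_const,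
      Finset.card_singleton, smul_eq_mul, one_mul]
    rw [pow_succ] at hW₁ hW₂
    omega
  · rw [volume_real_cellTimes (by linarith) (by linarith) (by linarith) (by linarith)]
    simp only [cond_true, cond_false, h₁, h₂, sub_sub_cancel, div_eq_inv_mul]

theorem measurableSet_cellTimes (a b : ℝ) (ζ : Fin d → ℝ) (k : Fin d → ℤ) :
    MeasurableSet (cellTimes a b ζ k) := by
  unfold cellTimes
  measurability

theorem cellTimes_subset {a b : ℝ} (ha : 0 ≤ a) (hb : b ≤ 1) (ζ : Fin d → ℝ) (k : Fin d → ℤ) :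
    cellTimes a b ζ k ⊆ Set.Ico 0 1 := fun _ ht => ⟨ha.trans ht.1.1, ht.1.2.trans_le hb⟩

/-- A time determines its patch by monotonicity of `Φ`, and then its cell by taking integer parts.
-/
theorem pairwise_disjoint_cellTimes {Φ : Fin (M + 1) → ℝ} (hΦ : Monotone Φ)
    (ζ : Fin M → Fin d → ℝ) (K : Finset (Fin d → ℤ)) :
    Pairwise (Function.onFun Disjoint fun p : Fin M × K =>
      cellTimes (Φ p.1.castSucc) (Φ p.1.succ) (ζ p.1) p.2) := by
  have key : ∀ (i i' : Fin M) (t : ℝ), t < Φ i.succ → Φ i'.castSucc ≤ t → i' ≤ i := by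
    intro i i' t h h'
    by_contra! hlt
    have := hΦ (Fin.succ_le_castSucc_iff.2 hlt)
    linarith
  rintro ⟨i, k, hk⟩ ⟨i', k', hk'⟩ hne
  refine Set.disjoint_left.2 fun t ht ht' => hne ?_
  obtain rfl : i = i' := le_antisymm (key _ _ t ht'.1.2 ht.1.1) (key _ _ t ht.1.2 ht'.1.1)
  obtain rfl : k = k' := funext fun j =>
    ((Int.floor_eq_iff (a := ζ i j + t)).2 (ht.2 j)).symm.trans (Int.floor_eq_iff.2 (ht'.2 j))
  rfl

theorem sum_volume_real_cellTimes {Φ : Fin (M + 1) → ℝ} (hΦ : Monotone Φ) (h0 : Φ 0 = 0)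
    (h1 : ∀ i, Φ i ≤ 1) (ζ : Fin M → Fin d → ℝ) (K : Finset (Fin d → ℤ)) :
    ∑ p : Fin M × K, volume.real (cellTimes (Φ p.1.castSucc) (Φ p.1.succ) (ζ p.1) p.2) =
      volume.real (⋃ p : Fin M × K, cellTimes (Φ p.1.castSucc) (Φ p.1.succ) (ζ p.1) p.2) := by
  rw [measureReal_iUnion_fintype (pairwise_disjoint_cellTimes hΦ ζ K)
    (fun p => measurableSet_cellTimes _ _ _ _) fun p => ?_]
  refine ((measure_mono (cellTimes_subset ?_ (h1 _) _ _)).trans_lt (by simp)).ne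
  rw [← h0]
  exact hΦ (Fin.zero_le _)

theorem sum_volume_real_cellTimes_le_one {Φ : Fin (M + 1) → ℝ} (hΦ : Monotone Φ) (h0 : Φ 0 = 0)
    (h1 : ∀ i, Φ i ≤ 1) (ζ : Fin M → Fin d → ℝ) (K : Finset (Fin d → ℤ)) :
    ∑ p : Fin M × K, volume.real (cellTimes (Φ p.1.castSucc) (Φ p.1.succ) (ζ p.1) p.2) ≤ 1 := by
  rw [sum_volume_real_cellTimes hΦ h0 h1]
  have : volume.real (Set.Ico (0 : ℝ) 1) = 1 := by simp
  rw [← this]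
  refine measureReal_mono (Set.iUnion_subset fun p => cellTimes_subset ?_ (h1 _) _ _) (by simp)
  rw [← h0]
  exact hΦ (Fin.zero_le _)

/-- The cell times partition `[0, 1)` as soon as the grid is large enough. -/
theorem sum_volume_real_cellTimes_eq_one {Φ : Fin (M + 1) → ℝ} (hΦ : Monotone Φ) (h0 : Φ 0 = 0)
    (h1 : ∀ i, Φ i ≤ 1) (hlast : Φ (Fin.last M) = 1) (ζ : Fin M → Fin d → ℝ)
    (K : Finset (Fin d → ℤ))
    (hK : ∀ i : Fin M, Φ i.castSucc < Φ i.succ → ∀ t ∈ Set.Ico (0 : ℝ) 1,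
      (fun j => ⌊ζ i j + t⌋) ∈ K) :
    ∑ p : Fin M × K, volume.real (cellTimes (Φ p.1.castSucc) (Φ p.1.succ) (ζ p.1) p.2) = 1 := by
  refine le_antisymm (sum_volume_real_cellTimes_le_one hΦ h0 h1 ζ K) ?_
  rw [sum_volume_real_cellTimes hΦ h0 h1]
  have : volume.real (Set.Ico (0 : ℝ) 1) = 1 := by simp
  rw [← this]
  refine measureReal_mono (fun t ht => ?_) ?_
  · obtain ⟨i, hi, hi'⟩ : ∃ i : Fin M, Φ i.castSucc ≤ t ∧ t < Φ i.succ := by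
      by_contra! hc
      have : ∀ i, Φ i ≤ t := fun i => by
        induction i using Fin.induction with
        | zero => rw [h0]; exact ht.1
        | succ i ih => exact hc i ih
      have := this (Fin.last M)
      rw [hlast] at this
      exact absurd ht.2 (not_lt.2 this)
    exact Set.mem_iUnion.2 ⟨(i, ⟨_, hK i (hi.trans_lt hi') t ht⟩), ⟨hi, hi'⟩,
      fun j => ⟨Int.floor_le _, Int.lt_floor_add_one _⟩⟩
  · refine ((measure_mono (Set.iUnion_subset fun p => cellTimes_subset ?_ (h1 _) _ _)).trans_lt
      (by simp : volume (Set.Ico (0 : ℝ) 1) < ⊤)).ne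
    rw [← h0]
    exact hΦ (Fin.zero_le _)

end Cells

/-! ### The approximating network, its stability and its size -/

section Approximation

variable {D d M : ℕ} {Γ : Set (EuclideanSpace ℝ (Fin D))} {δ : ℝ}

/-- Tangential coordinates at a point of a submanifold with a projection radius. -/
theorem IsSmoothSubmanifold.exists_coordinates (hΓ : IsSmoothSubmanifold d Γ)
    (hδ : IsProjectionRadius Γ δ) {y : EuclideanSpace ℝ (Fin D)} (hy : y ∈ Γ) :
    ∃ Q : EuclideanSpace ℝ (Fin D) →L[ℝ] EuclideanSpace ℝ (Fin d), ‖Q‖ ≤ 1 ∧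
      ∀ x ∈ Metric.ball y δ ∩ Γ, ∀ x' ∈ Metric.ball y δ ∩ Γ, ‖x - x'‖ ≤ 2 * ‖Q (x - x')‖ := by
  let e := ((stdOrthonormalBasis ℝ (tangentSpaceAt Γ y)).reindex
    (finCongr (hΓ.finrank_tangentSpaceAt hy))).repr
  have he : ∀ v, ‖e (tangentProj Γ y v)‖ = ‖tangentProj Γ y v‖ := fun v => e.norm_map _
  refine ⟨(e : tangentSpaceAt Γ y →L[ℝ] EuclideanSpace ℝ (Fin d)) ∘L tangentProj Γ y,
    ContinuousLinearMap.opNorm_le_bound _ zero_le_one fun v => ?_, fun x hx x' hx' => ?_⟩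
  · rw [one_mul]
    exact (he v).trans_le (Submodule.norm_orthogonalProjectionOnto_apply_le _ v)
  · obtain ⟨-, g, hg, -, hL⟩ := hδ y hy
    have := hL.dist_le_mul _ (Set.mem_image_of_mem _ hx) _ (Set.mem_image_of_mem _ hx')
    rw [hg x hx, hg x' hx', dist_eq_norm, dist_eq_norm, ← map_sub] at this
    exact this.trans_eq (by rw [← he]; rfl)

/-- Lipschitz functions on a submanifold are approximated by networks, in a way that is stable
under perturbations of the input. -/
theorem IsSmoothSubmanifold.exists_network (hΓ : IsSmoothSubmanifold d Γ) (hD : 1 ≤ D)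
    (hd : 1 ≤ d) (hM : 0 < M) (hδ0 : 0 < δ) (hδ : IsProjectionRadius Γ δ)
    {y : Fin M → EuclideanSpace ℝ (Fin D)} (hy : ∀ i, y i ∈ Γ)
    (hcov : Γ ⊆ ⋃ i, Metric.ball (y i) (δ / 4)) :
    ∃ (Q : Fin M → EuclideanSpace ℝ (Fin D) →L[ℝ] EuclideanSpace ℝ (Fin d)) (K : ℕ),
      (∀ i, ‖Q i‖ ≤ 1) ∧
      ∀ (q : ℕ) (C : ℝ≥0), 0 < C →
      ∀ f : EuclideanSpace ℝ (Fin D) → EuclideanSpace ℝ (Fin q),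
        LipschitzOnWith C f Γ → Set.MapsTo f Γ (unitCube q) →
      ∀ ε : ℝ, 0 < ε → ∃ Φ : NeuralNetwork D q,
        Φ.depth = Nat.clog 2 d + Nat.clog 2 D + 8 ∧
        Φ.weights ≤ K + (36 * 2 ^ Nat.clog 2 d + 5 + q) *
          (M * (2 * (⌈4 * C * d * δ / ε⌉₊ + 1) + 1) ^ d) ∧
        (∀ x, Φ.realization x ∈ unitCube q) ∧
        ∀ x ∈ Γ, ∀ v, ‖v‖ ≤ δ / 12 → ∀ B, (∀ i, ‖Q i v‖ ≤ B) →
          ‖Φ.realization (x + v) - f x‖ ≤ 2 * C * B + ε / 2 := by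
  choose Q hQ1 hQ using fun i => hΓ.exists_coordinates hδ (hy i)
  obtain ⟨W, F, φ, hF, hFφ, hFQ, hφ0, hφmono, hφ1, hφsupp, hφlast⟩ :=
    exists_reluStack_features y hD hd hM Q hδ0 (Nat.clog 2 D)
  have hφnn : ∀ x i, 0 ≤ φ x i := fun x i => (hφ0 x).symm.trans_le (hφmono x (Fin.zero_le i))
  refine ⟨Q, W, hQ1, fun q C hC f hf hfq ε hε => ?_⟩
  have hC' : (0 : ℝ) < C := hC
  have hd' : (0 : ℝ) < d := by exact_mod_cast hd
  -- Chosen so that the discretisation error `2 * C * (h * d)` equals `ε / 2`.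
  set h : ℝ := ε / (4 * C * d) with hh
  have hh0 : 0 < h := by positivity
  -- Rescaled coordinates are at most `δ / h ≤ N - 1` in size; the extra 1 absorbs the shift by `t`.
  set N : ℕ := ⌈4 * C * d * δ / ε⌉₊ + 1 with hN
  have hNδ : δ / h ≤ N - 1 := by
    rw [hN, hh]
    push_cast
    rw [add_sub_cancel_right]
    refine le_trans (le_of_eq ?_) (Nat.le_ceil _)
    field_simp
  let K : Finset (Fin d → ℤ) := Fintype.piFinset fun _ => Finset.Icc (-(N : ℤ)) N
  have hKcard : K.card = (2 * N + 1) ^ d := by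
    simp only [K, Fintype.card_piFinset_const, Int.card_Icc]
    congr 1
    omega
  have hKne : (0 : Fin d → ℤ) ∈ K := by simp [K]
  have : Nonempty (Fin M × K) := ⟨⟨0, hM⟩, 0, hKne⟩
  let z : (Fin d → ℤ) → EuclideanSpace ℝ (Fin d) := fun k => WithLp.toLp 2 fun j => h * k j
  have hLip : ∀ i, ∀ x ∈ Metric.ball (y i) δ ∩ Γ, ∀ x' ∈ Metric.ball (y i) δ ∩ Γ,
      ‖f x - f x'‖ ≤ 2 * C * ‖Q i (x - y i) - Q i (x' - y i)‖ := fun i x hx x' hx' => by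
    have e1 := hf.dist_le_mul x hx.2 x' hx'.2
    rw [dist_eq_norm, dist_eq_norm] at e1
    have e2 := hQ i x hx x' hx'
    rw [← map_sub, sub_sub_sub_cancel_right]
    calc ‖f x - f x'‖ ≤ C * ‖x - x'‖ := e1
      _ ≤ C * (2 * ‖Q i (x - x')‖) := by gcongr
      _ = _ := by ring
  -- On a patch `f` is a `2 * C`-Lipschitz function of the tangential coordinates; it is extended to
  -- the single grid point `z p.2`.
  have hval : ∀ p : Fin M × K, ∃ w ∈ unitCube q, ∀ x : ↥(Metric.ball (y p.1) δ ∩ Γ),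
      ‖f x - w‖ ≤ 2 * C * ‖Q p.1 (x - y p.1) - z p.2‖ := fun p =>
    exists_mem_unitCube_norm_sub_le
      (a := fun x : ↥(Metric.ball (y p.1) δ ∩ Γ) => Q p.1 (x - y p.1)) (b := fun x => f x)
      (by positivity) (fun x => hfq x.2.2) (fun x x' => hLip p.1 x x.2 x' x'.2) _
  choose w hwq hw using hval
  choose Wc G hWc hG hGval using fun p : Fin M × K => exists_reluStack_cell p.1 h p.2.1
  let χ : EuclideanSpace ℝ (Fin D) → Fin M × K → ℝ := fun x p =>
    volume.real (cellTimes (φ x p.1.castSucc) (φ x p.1.succ) (fun j => Q p.1 (x - y p.1) j / h) p.2)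
  have hGχ : ∀ x p, G p (F x.ofLp) () = χ x p := fun x p => by
    rw [hGval]
    · simp only [hFφ, hFQ, sub_sub_cancel, χ]
    all_goals
      rw [hFφ]
      linarith [hφnn x p.1.castSucc, hφ1 x p.1.castSucc, hφnn x p.1.succ, hφ1 x p.1.succ]
  have hχ0 : ∀ x p, 0 ≤ χ x p := fun x p => measureReal_nonneg
  have hχ1 : ∀ x, ∑ p, χ x p ≤ 1 := fun x =>
    sum_volume_real_cellTimes_le_one (hφmono x) (hφ0 x) (hφ1 x)
      (fun i j => Q i (x - y i) j / h) K
  obtain ⟨Φ, hΦL, hΦW, hΦ⟩ := (hF.trans (ReluStack.sigma hG)).exists_neuralNetwork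
    (m := q) (w := fun _ => ∑ _p : Fin M × K, 1)
    (ℓ := fun j z => ∑ p : Fin M × K, w p j * z ⟨p, ()⟩)
    (fun j => .sum _ fun p _ => (IsSparseAffine.coord _).const_mul _) (Equiv.refl _)
  have hR : ∀ x, Φ.realization x = ∑ p, χ x p • w p := fun x => by
    ext j
    simp only [NeuralNetwork.realization, hΦ, Equiv.refl_apply]
    rw [WithLp.ofLp_sum, Finset.sum_apply]
    exact Finset.sum_congr rfl fun p _ => by
      rw [show G p (F fun i => x.ofLp i) () = χ x p from hGχ x p]
      simp [mul_comm]
  refine ⟨Φ, by rw [hΦL]; omega, ?_, fun x j => ?_, fun x hx v hv B hB => ?_⟩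
  · have hcard : Fintype.card (Fin M × K) = M * (2 * N + 1) ^ d := by
      rw [Fintype.card_prod, Fintype.card_fin, Fintype.card_coe, hKcard]
    have h1 : ∑ p, Wc p ≤ (M * (2 * N + 1) ^ d) * (36 * 2 ^ Nat.clog 2 d + 5) := by
      rw [← hcard, ← smul_eq_mul, ← Finset.card_univ, ← Finset.sum_const]
      exact Finset.sum_le_sum fun p _ => hWc p
    have h2 : ∑ _j : Fin q, ∑ _p : Fin M × K, 1 = q * (M * (2 * N + 1) ^ d) := by
      rw [← hcard]
      simp
    rw [h2] at hΦW
    linarith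
  · rw [hR]
    simp only [WithLp.ofLp_sum, Finset.sum_apply, PiLp.smul_apply, smul_eq_mul]
    refine ⟨Finset.sum_nonneg fun p _ => mul_nonneg (hχ0 x p) (hwq p j).1,
      le_trans (Finset.sum_le_sum fun p _ => ?_) (hχ1 x)⟩
    exact mul_le_of_le_one_right (hχ0 x p) (hwq p j).2
  · obtain ⟨i₀, hi₀⟩ := Set.mem_iUnion.1 (hcov hx)
    rw [mem_ball_iff_norm] at hi₀
    set X := x + v with hX
    have hXy : ∀ i, X - y i = x - y i + v := fun i => by rw [hX]; abel
    -- The margins add up to `δ / 4 + δ / 12 = δ / 3`, so some bump still equals 1 at the perturbed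
    -- point.
    have hlast : φ X (Fin.last M) = 1 := hφlast X i₀ (by
      rw [hXy]
      linarith [norm_add_le (x - y i₀) v])
    have hcoord : ∀ i u j, |Q i u j| ≤ ‖u‖ := fun i u j =>
      (PiLp.norm_apply_le (Q i u) j).trans
        (((Q i).le_opNorm u).trans (mul_le_of_le_one_left (norm_nonneg _) (hQ1 i)))
    have hsum : ∑ p, χ X p = 1 := by
      refine sum_volume_real_cellTimes_eq_one (hφmono X) (hφ0 X) (hφ1 X) hlast
        (fun i j => Q i (X - y i) j / h) K fun i hi t ht => ?_
      have h1 := hφsupp X i hi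
      refine Fintype.mem_piFinset.2 fun j => Finset.mem_Icc.2 ?_
      have h2 : |Q i (X - y i) j / h| ≤ N - 1 := by
        rw [abs_div, abs_of_pos hh0]
        refine le_trans ?_ hNδ
        gcongr
        linarith [hcoord i (X - y i) j]
      rw [abs_le] at h2
      refine ⟨Int.le_floor.2 ?_, Int.lt_add_one_iff.1 (Int.floor_lt.2 ?_)⟩
      · push_cast
        linarith [ht.1]
      · push_cast
        linarith [ht.2]
    have hdiff : Φ.realization X - f x = ∑ p, χ X p • (w p - f x) := by
      simp only [smul_sub, Finset.sum_sub_distrib, ← Finset.sum_smul, hsum, one_smul, hR]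
    have hterm : ∀ p, χ X p * ‖w p - f x‖ ≤ χ X p * (2 * C * B + ε / 2) := fun p => by
      rcases (cellTimes (φ X p.1.castSucc) (φ X p.1.succ) (fun j => Q p.1 (X - y p.1) j / h)
        p.2).eq_empty_or_nonempty with hemp | ⟨t, ht, htk⟩
      · have : χ X p = 0 := by simp only [χ, hemp, measureReal_empty]
        simp [this]
      refine mul_le_mul_of_nonneg_left ?_ (hχ0 X p)
      have h1 := hφsupp X p.1 (ht.1.trans_lt ht.2)
      -- A patch active at `X` contains the unperturbed `x`, since `5 / 6 + 1 / 12 < 1`.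
      have hxball : x ∈ Metric.ball (y p.1) δ ∩ Γ := by
        refine ⟨mem_ball_iff_norm.2 ?_, hx⟩
        have : x - y p.1 = (X - y p.1) - v := by rw [hXy]; abel
        rw [this]
        linarith [norm_sub_le (X - y p.1) v]
      have h2 := hw p ⟨x, hxball⟩
      have ht0 : 0 ≤ t := (hφnn X _).trans ht.1
      have ht1 : t < 1 := ht.2.trans_le (hφ1 X _)
      -- Since `0 ≤ t < 1`, each rescaled coordinate is within 1 of `k`; the factor `√d` is relaxed
      -- to `d`.
      have h3 : ‖Q p.1 (X - y p.1) - z p.2‖ ≤ h * d := by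
        refine (pow_le_pow_iff_left₀ (norm_nonneg _) (by positivity) two_ne_zero).1 ?_
        rw [EuclideanSpace.real_norm_sq_eq]
        have hj : ∀ j, (Q p.1 (X - y p.1) - z p.2) j ^ 2 ≤ h ^ 2 := fun j => by
          rw [← sq_abs]
          refine pow_le_pow_left₀ (abs_nonneg _) ?_ 2
          have e1 : (Q p.1 (X - y p.1) - z p.2) j =
              h * (Q p.1 (X - y p.1) j / h - (p.2 : Fin d → ℤ) j) := by
            simp only [PiLp.sub_apply, z]
            field_simp
          rw [e1, abs_mul, abs_of_pos hh0]
          refine mul_le_of_le_one_right hh0.le (abs_le.2 ⟨?_, ?_⟩)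
          · linarith [(htk j).1]
          · linarith [(htk j).2]
        calc _ ≤ ∑ _j : Fin d, h ^ 2 := Finset.sum_le_sum fun j _ => hj j
          _ = h ^ 2 * d := by simp [mul_comm]
          _ ≤ h ^ 2 * (d * d) := by
            gcongr
            exact le_mul_of_one_le_left hd'.le (by exact_mod_cast hd)
          _ = _ := by ring
      have h4 : Q p.1 (x - y p.1) - z p.2 = (Q p.1 (X - y p.1) - z p.2) - Q p.1 v := by
        rw [hXy, map_add]
        abel
      have h5 : ‖Q p.1 (x - y p.1) - z p.2‖ ≤ h * d + B := by
        rw [h4]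
        exact (norm_sub_le _ _).trans (add_le_add h3 (hB p.1))
      rw [norm_sub_rev]
      calc _ ≤ 2 * C * ‖Q p.1 (x - y p.1) - z p.2‖ := h2
        _ ≤ 2 * C * (h * d + B) := by gcongr
        _ = _ := by
          rw [hh]
          field_simp
          ring
    rw [hdiff]
    calc _ ≤ ∑ p, χ X p * ‖w p - f x‖ := (norm_sum_le _ _).trans_eq
          (Finset.sum_congr rfl fun p _ => by rw [norm_smul, Real.norm_of_nonneg (hχ0 X p)])
      _ ≤ ∑ p, χ X p * (2 * C * B + ε / 2) := Finset.sum_le_sum fun p _ => hterm p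
      _ = _ := by rw [← Finset.sum_mul, hsum, one_mul]

/-- The zero network of a given depth. -/
theorem exists_zero_network (n q L : ℕ) : ∃ Φ : NeuralNetwork n q, Φ.depth = L + 1 ∧
    Φ.weights = 0 ∧ ∀ x, Φ.eval x = 0 := by
  induction L generalizing n with
  | zero => exact ⟨.output 0 0, rfl, by simp [NeuralNetwork.weights, NeuralNetwork.layerWeights],
      fun x => by simp [NeuralNetwork.eval]⟩
  | succ L ih =>
    obtain ⟨Φ, hL, hW, hΦ⟩ := ih 1
    exact ⟨.layer one_pos 0 0 Φ, by simp [NeuralNetwork.depth, hL],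
      by simp [NeuralNetwork.weights, NeuralNetwork.layerWeights, hW],
      fun x => by simp [NeuralNetwork.eval, hΦ]⟩

theorem norm_sub_sq_le_of_mem_unitCube {q : ℕ} {a b : EuclideanSpace ℝ (Fin q)}
    (ha : a ∈ unitCube q) (hb : b ∈ unitCube q) : ‖a - b‖ ^ 2 ≤ q := by
  rw [EuclideanSpace.real_norm_sq_eq]
  calc _ ≤ ∑ _j : Fin q, (1 : ℝ) := Finset.sum_le_sum fun j _ => by
        rw [PiLp.sub_apply, sq_le_one_iff_abs_le_one, abs_le]
        constructor <;> linarith [(ha j).1, (ha j).2, (hb j).1, (hb j).2]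
    _ = q := by simp

/-- The number of weights of the approximating network in terms of the accuracy. -/
theorem card_weights_le {K d q M : ℕ} (hM : 0 < M) (hq : 1 ≤ q) {C δ ε : ℝ} (hC : 0 < C)
    (hδ : 0 < δ) (hε : 0 < ε) (hε1 : ε < 1) :
    ((K + (36 * 2 ^ Nat.clog 2 d + 5 + q) *
      (M * (2 * (⌈4 * C * d * δ / ε⌉₊ + 1) + 1) ^ d) : ℕ) : ℝ) ≤
    (36 * 2 ^ Nat.clog 2 d + 6) * (8 * C * d * max 1 δ + 5) ^ d *
      (q * (M : ℝ) ^ (d + 1) * (ε⁻¹) ^ d) + K := by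
  have hM' : (1 : ℝ) ≤ M := by exact_mod_cast hM
  have hq' : (1 : ℝ) ≤ q := by exact_mod_cast hq
  have h1 : (2 * (⌈4 * C * d * δ / ε⌉₊ + 1) + 1 : ℝ) ≤ (8 * C * d * max 1 δ + 5) * ε⁻¹ := by
    have e1 := (Nat.ceil_lt_add_one (a := 4 * C * d * δ / ε) (by positivity)).le
    have e2 : 4 * C * d * δ / ε ≤ 4 * C * d * max 1 δ * ε⁻¹ := by
      rw [div_eq_mul_inv]
      gcongr
      exact le_max_right _ _
    have e3 : 1 ≤ ε⁻¹ := (one_le_inv₀ hε).2 hε1.le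
    linarith
  have h2 : (36 * 2 ^ Nat.clog 2 d + 5 + q : ℝ) ≤ (36 * 2 ^ Nat.clog 2 d + 6) * q := by
    have : (0 : ℝ) ≤ 36 * 2 ^ Nat.clog 2 d + 5 := by positivity
    nlinarith
  have h3 : (M : ℝ) ≤ M ^ (d + 1) := le_self_pow₀ hM' (by omega)
  push_cast
  rw [add_comm]
  refine add_le_add ?_ le_rfl
  calc _ ≤ ((36 * 2 ^ Nat.clog 2 d + 6) * q) *
        (M ^ (d + 1) * ((8 * C * d * max 1 δ + 5) * ε⁻¹) ^ d) := by gcongr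
    _ = _ := by rw [mul_pow]; ring

end Approximation

/-! ### The noise estimate -/

/-- On large noise the squared error can be as big as `q`; widening the threshold by the factor `2 *
q` lets the Gaussian tail absorb it. -/
theorem mul_exp_neg_le {q : ℕ} (hq : 1 ≤ q) {a : ℝ} (ha : 1 / 2 ≤ a) :
    q * Real.exp (-(4 * q ^ 2 * a)) ≤ Real.exp (-a) := by
  have hq' : (1 : ℝ) ≤ q := by exact_mod_cast hq
  have h1 : (q : ℝ) ≤ Real.exp (q - 1) := by linarith [Real.add_one_le_exp ((q : ℝ) - 1)]
  calc q * Real.exp (-(4 * q ^ 2 * a)) ≤ Real.exp (q - 1) * Real.exp (-(4 * q ^ 2 * a)) := by gcongr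
    _ = Real.exp (q - 1 - 4 * q ^ 2 * a) := by rw [← Real.exp_add]; ring_nf
    _ ≤ Real.exp (-a) := by
      refine Real.exp_le_exp.2 ?_
      nlinarith [mul_nonneg (sub_nonneg.2 ha) (sub_nonneg.2 hq'), mul_self_nonneg ((q : ℝ) - 1)]

/-- The noise estimate for a map that is stable under small perturbations. -/
theorem IsGaussianNoise.lintegral_iSup_le {Ω : Type*} [MeasurableSpace Ω] {P : Measure Ω}
    [IsProbabilityMeasure P] {D d q M : ℕ} {σ : ℝ≥0} {η : Ω → EuclideanSpace ℝ (Fin D)}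
    (hη : IsGaussianNoise P σ η) (hσ : 0 < σ) (hD : 1 ≤ D) (hM : 0 < M) (hq : 1 ≤ q)
    {Q : Fin M → EuclideanSpace ℝ (Fin D) →L[ℝ] EuclideanSpace ℝ (Fin d)} (hQ : ∀ i, ‖Q i‖ ≤ 1)
    {r₀ ε : ℝ} (hr₀ : 0 < r₀) (hσr : (σ : ℝ) ^ 2 ≤ r₀ ^ 2) {C : ℝ≥0} (hε : 0 < ε)
    {Γ : Set (EuclideanSpace ℝ (Fin D))}
    {R : EuclideanSpace ℝ (Fin D) → EuclideanSpace ℝ (Fin q)} (hR : ∀ x, R x ∈ unitCube q)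
    (hstab : ∀ x ∈ Γ, ∀ v, ‖v‖ ≤ D * (2 * q * r₀) → ∀ B, (∀ i, ‖Q i v‖ ≤ B) →
      ‖R (x + v) - R x‖ ≤ 2 * C * B + ε) :
    ∫⁻ s, ⨆ x ∈ Γ, ‖R (x + η s) - R x‖ₑ ^ 2 ∂P ≤
      ENNReal.ofReal
        (8 * (C : ℝ) ^ 2 / D * (∫ s, ‖η s‖ ^ 2 ∂P) *
            (Real.sqrt (2 * d * Real.log M) + 2 * Real.log M + d)
          + 8 * ε ^ 2
          + 2 * D * Real.exp (-(r₀ ^ 2 / (2 * (σ : ℝ) ^ 2)))) := by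
  have hσ' : (0 : ℝ) < σ := hσ
  have hD' : (0 : ℝ) < D := by exact_mod_cast hD
  have hq' : (1 : ℝ) ≤ q := by exact_mod_cast hq
  have hM' : (1 : ℝ) ≤ M := by exact_mod_cast hM
  have hlog : 0 ≤ Real.log M := Real.log_nonneg hM'
  have : Nonempty (Fin M) := ⟨⟨0, hM⟩⟩
  set ρ : ℝ := 2 * q * r₀ with hρ
  have hρ0 : 0 < ρ := by positivity
  choose m hm using fun s => Finite.exists_max fun i => ‖Q i (η s)‖
  let X : Ω → ℝ := fun s => ‖Q (m s) (η s)‖ ^ 2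
  let bad : Set Ω := {s | ∃ j, ρ ≤ |η s j|}
  have hbad : NullMeasurableSet bad P := by
    have h1 : bad = ⋃ j, {s | ρ ≤ |η s j|} := by ext; simp [bad]
    rw [h1]
    refine NullMeasurableSet.iUnion fun j => ?_
    have := (hη.2 j).aemeasurable
    exact nullMeasurableSet_le aemeasurable_const this.abs
  have hpt : ∀ s, ⨆ x ∈ Γ, ‖R (x + η s) - R x‖ₑ ^ 2 ≤
      ENNReal.ofReal (24 / 5 * C ^ 2 * X s) + (ENNReal.ofReal (6 * ε ^ 2) +
        bad.indicator (fun _ => (q : ℝ≥0∞)) s) := fun s => by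
    refine iSup₂_le fun x hx => ?_
    rw [← ofReal_norm, ← ENNReal.ofReal_pow (norm_nonneg _)]
    by_cases hs : s ∈ bad
    · rw [Set.indicator_of_mem hs, ← ENNReal.ofReal_natCast]
      exact (ENNReal.ofReal_le_ofReal (norm_sub_sq_le_of_mem_unitCube (hR _) (hR _))).trans
        (le_add_self.trans le_add_self)
    · rw [Set.indicator_of_notMem hs, add_zero, ← ENNReal.ofReal_add (by positivity) (by positivity)]
      refine ENNReal.ofReal_le_ofReal ?_
      have hsmall : ∀ j, |η s j| < ρ := fun j => not_le.1 fun h => hs ⟨j, h⟩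
      have hnorm : ‖η s‖ ≤ D * ρ := by
        refine (pow_le_pow_iff_left₀ (norm_nonneg _) (by positivity) two_ne_zero).1 ?_
        rw [EuclideanSpace.real_norm_sq_eq]
        calc _ ≤ ∑ _j : Fin D, ρ ^ 2 := Finset.sum_le_sum fun j _ => by
              rw [← sq_abs]
              exact pow_le_pow_left₀ (abs_nonneg _) (hsmall j).le 2
          _ = D * ρ ^ 2 := by simp
          _ ≤ (D * D) * ρ ^ 2 := by
            gcongr
            exact le_mul_of_one_le_left hD'.le (by exact_mod_cast hD)
          _ = _ := by ring
      have h1 := hstab x hx (η s) hnorm _ (hm s)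
      -- Young's inequality with weights `1 / 5` and `5` yields the factors `24 / 5` and `6`. As `24
      -- / 5 * (10 / 3) = 16`, the moment bound becomes `8 * C ^ 2 * σ ^ 2 * (2 * log M + d)`.
      have h2 : 2 * C * ‖Q (m s) (η s)‖ * ε * 2 ≤
          1 / 5 * (2 * C * ‖Q (m s) (η s)‖) ^ 2 + 5 * ε ^ 2 := by
        nlinarith [sq_nonneg (2 * C * ‖Q (m s) (η s)‖ - 5 * ε)]
      calc _ ≤ (2 * C * ‖Q (m s) (η s)‖ + ε) ^ 2 := by gcongr
        _ ≤ _ := by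
          simp only [X]
          linarith
  have htail : (q : ℝ≥0∞) * P bad ≤
      ENNReal.ofReal (2 * D * Real.exp (-(r₀ ^ 2 / (2 * (σ : ℝ) ^ 2)))) := by
    refine (mul_le_mul_right (hη.measure_exists_ge_le hρ0.le) _).trans ?_
    rw [← ENNReal.ofReal_natCast, ← ENNReal.ofReal_mul (by positivity)]
    refine ENNReal.ofReal_le_ofReal ?_
    have h1 : 1 / 2 ≤ r₀ ^ 2 / (2 * (σ : ℝ) ^ 2) := by
      rw [div_le_div_iff₀ (by norm_num) (by positivity)]
      linarith
    have h2 := mul_exp_neg_le hq h1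
    have h3 : ρ ^ 2 / (2 * (σ : ℝ) ^ 2) = 4 * q ^ 2 * (r₀ ^ 2 / (2 * (σ : ℝ) ^ 2)) := by
      rw [hρ]
      ring
    rw [h3]
    nlinarith
  have hmax := hη.lintegral_max_norm_sq_le hσ hM Q hQ (X := X) (fun s => ⟨m s, rfl⟩)
    (c := 24 / 5 * C ^ 2) (by positivity)
  calc _ ≤ ∫⁻ s, ENNReal.ofReal (24 / 5 * C ^ 2 * X s) + (ENNReal.ofReal (6 * ε ^ 2) +
        bad.indicator (fun _ => (q : ℝ≥0∞)) s) ∂P := lintegral_mono hpt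
    _ = ∫⁻ s, ENNReal.ofReal (24 / 5 * C ^ 2 * X s) ∂P + (ENNReal.ofReal (6 * ε ^ 2) +
        q * P bad) := by
      have hmeas : AEMeasurable (fun s => ENNReal.ofReal (6 * ε ^ 2) +
          bad.indicator (fun _ => (q : ℝ≥0∞)) s) P :=
        AEMeasurable.const_add (aemeasurable_const.indicator₀ hbad) _
      -- `X` comes from an arbitrary choice of maximiser, so only the other summand is known to be
      -- measurable.
      rw [lintegral_add_right' _ hmeas,
        lintegral_add_left measurable_const, lintegral_const, measure_univ, mul_one,
        lintegral_indicator_const₀ hbad]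
    _ ≤ ENNReal.ofReal (24 / 5 * C ^ 2 * (10 / 3 * σ ^ 2 * (Real.log M + d / 2))) +
        (ENNReal.ofReal (6 * ε ^ 2) +
          ENNReal.ofReal (2 * D * Real.exp (-(r₀ ^ 2 / (2 * (σ : ℝ) ^ 2))))) := by gcongr
    _ ≤ _ := by
      rw [← ENNReal.ofReal_add (by positivity) (by positivity),
        ← ENNReal.ofReal_add (by positivity) (by positivity), hη.integral_norm_sq]
      refine ENNReal.ofReal_le_ofReal ?_
      have h1 : 8 * (C : ℝ) ^ 2 / D * (D * σ ^ 2) = 8 * C ^ 2 * σ ^ 2 := by field_simp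
      -- The square-root term of the target is pure slack.
      have h2 : 0 ≤ 8 * (C : ℝ) ^ 2 * σ ^ 2 * √(2 * d * Real.log M) := by positivity
      rw [h1]
      nlinarith [sq_nonneg ε]

/-! ### Assembly -/

theorem mainTheorem1 :
    -- existence of `δ`
    (∀ (D d : ℕ) (Γ K Γ' : Set (EuclideanSpace ℝ (Fin D))), 1 ≤ d →
      IsSmoothSubmanifold d Γ → IsSmoothSubmanifold d Γ' → IsCompact K → Γ ⊆ K → K ⊆ Γ' →
      ∃ δ : ℝ, 0 < δ ∧ IsProjectionRadius Γ δ) ∧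
    -- the universal constant `c`, and `K₁`, which depends on `d`, `C` and `max 1 δ` only
    ∃ (c : ℕ) (K₁ : ℕ → ℝ≥0 → ℝ → ℝ), 0 < c ∧
      ∀ (D d : ℕ), 1 ≤ D → 1 ≤ d →
      ∀ Γ : Set (EuclideanSpace ℝ (Fin D)), Γ ⊆ unitCube D → IsSmoothSubmanifold d Γ →
      ∀ δ : ℝ, 0 < δ → IsProjectionRadius Γ δ →
      ∀ M : ℕ, IsMinimalCover Γ (δ / 4) M →
      -- the additive constant `K₂`, which depends on `Γ`, `δ` and `C` only
      ∃ K₂ : ℝ≥0 → ℝ,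
      ∀ q : ℕ, 1 ≤ q →
      ∃ r₀ : ℝ, 0 < r₀ ∧
      ∀ C : ℝ≥0, 0 < C →
      ∀ f : EuclideanSpace ℝ (Fin D) → EuclideanSpace ℝ (Fin q),
        LipschitzOnWith C f Γ → Set.MapsTo f Γ (unitCube q) →
      ∀ ε : ℝ, 0 < ε → ε < 1 →
      ∃ Φ : NeuralNetwork D q,
        (∀ x ∈ Γ, ‖f x - Φ.realization x‖ ≤ ε) ∧
        (Φ.weights : ℝ) ≤ K₁ d C (max 1 δ) * (q * (M : ℝ) ^ (d + 1) * (ε⁻¹) ^ d) + K₂ C ∧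
        Φ.depth = Nat.clog 2 d + Nat.clog 2 D + c ∧
        Set.MapsTo Φ.realization (unitCube D) (unitCube q) ∧
        ∀ (Ω : Type*) [MeasurableSpace Ω] (P : Measure Ω) [IsProbabilityMeasure P] (σ : ℝ≥0)
          (η : Ω → EuclideanSpace ℝ (Fin D)),
          0 < σ → (σ : ℝ) ^ 2 ≤ r₀ ^ 2 → IsGaussianNoise P σ η →
          ∫⁻ s, ⨆ x ∈ Γ, ‖Φ.realization (x + η s) - Φ.realization x‖ₑ ^ 2 ∂P ≤
            ENNReal.ofReal
              (8 * (C : ℝ) ^ 2 / D * (∫ s, ‖η s‖ ^ 2 ∂P) *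
                  (Real.sqrt (2 * d * Real.log M) + 2 * Real.log M + d)
                + 8 * ε ^ 2
                + 2 * D * Real.exp (-(r₀ ^ 2 / (2 * (σ : ℝ) ^ 2)))) := by
  refine ⟨fun D d Γ K Γ' _ hΓ hΓ' hK hΓK hKΓ => hΓ.exists_isProjectionRadius hΓ' hK hΓK hKΓ, 8,
    fun d C Δ => (36 * 2 ^ Nat.clog 2 d + 6) * (8 * C * d * Δ + 5) ^ d, by norm_num, ?_⟩
  intro D d hD hd Γ _ hΓ δ hδ0 hδ M hM
  obtain ⟨⟨y, hy, hcov⟩, hmin⟩ := hM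
  rcases Γ.eq_empty_or_nonempty with rfl | ⟨x₀, hx₀⟩
  -- For empty `Γ` there are no patches to build on, and a zero network of the prescribed depth
  -- suffices.
  · have hM0 : M = 0 := Nat.le_zero.1 (hmin ⟨Fin.elim0, fun i => i.elim0, by simp⟩)
    subst hM0
    refine ⟨0, fun q _ => ⟨1, one_pos, fun C _ f _ _ ε _ _ => ?_⟩⟩
    obtain ⟨Φ, hL, hW, hΦ⟩ := exists_zero_network D q (Nat.clog 2 d + Nat.clog 2 D + 7)
    refine ⟨Φ, by simp, by simp [hW], hL, fun x _ j => ?_, fun Ω _ P _ σ η _ _ _ => by simp⟩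
    simp [NeuralNetwork.realization, hΦ]
  have hM : 0 < M := by
    obtain ⟨i, -⟩ := Set.mem_iUnion.1 (hcov hx₀)
    exact i.pos
  obtain ⟨Q, K, hQ, hnet⟩ := hΓ.exists_network hD hd hM hδ0 hδ hy hcov
  refine ⟨fun _ => K, fun q hq => ?_⟩
  have hD' : (0 : ℝ) < D := by exact_mod_cast hD
  have hq' : (0 : ℝ) < q := by exact_mod_cast hq
  -- This makes `D * (2 * q * r₀) = δ / 12`, the perturbation that the network tolerates.
  refine ⟨δ / (24 * D * q), by positivity, fun C hC f hf hfq ε hε hε1 => ?_⟩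
  obtain ⟨Φ, hL, hW, hcube, hstab⟩ := hnet q C hC f hf hfq ε hε
  have happrox : ∀ x ∈ Γ, ‖Φ.realization x - f x‖ ≤ ε / 2 := fun x hx => by
    simpa using hstab x hx 0 (by simp; positivity) 0 (by simp)
  refine ⟨Φ, fun x hx => ?_, ?_, hL, fun x _ => hcube x, ?_⟩
  · rw [norm_sub_rev]
    linarith [happrox x hx]
  · exact (Nat.cast_le.2 hW).trans (card_weights_le hM hq hC hδ0 hε hε1)
  · intro Ω _ P _ σ η hσ hσr hη
    refine hη.lintegral_iSup_le hσ hD hM hq hQ (by positivity) hσr hε hcube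
      fun x hx v hv B hB => ?_
    have h1 := hstab x hx v (hv.trans_eq (by field_simp; norm_num)) B hB
    have h2 := norm_sub_le (Φ.realization (x + v) - f x) (Φ.realization x - f x)
    rw [sub_sub_sub_cancel_right] at h2
    linarith [happrox x hx]
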